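/- **Setting.** Let $T$ be a complete first-order theory in a countable vocabulary $L$ without function symbols (constant symbols are allowed), and let $P\in L$ be a unary predicate such that $T$ implies that $P$ is infinite. Let $\mathcal C$ be the monster model of $T$; all models are elementary submodels of $\mathcal C$, all sets are (small) subsets of $\mathcal C$, and each set is regarded as a substructure of $\mathcal C$ (with respect to the predicates of $L$). Put $P^A=A\cap P^{\mathcal C}$ and let $T^P$ be the theory of the structure $P^{\mathcal C}$. Assume: * $P$ is stably embedded: every subset of a power of $P^{\mathcal C}$ that is definable in $\mathcal C$ with parameters is definable in $\mathcal C$ with parameters from $P^{\mathcal C}$; * $T$ has quantifier elimination down to the predicates: every formula is equivalent modulo $T$ to a quantifier-free formula in the predicate symbols (for example to a single predicate). **Definitions.** A set $A$ is *complete* if for every formula $\psi(\bar x,\bar y)$ and every finite tuple $\bar b$ in $A$, if $\models(\exists\bar x\in P)\,\psi(\bar x,\bar b)$ then $\models\psi(\bar a,\bar b)$ for some tuple $\bar a$ in $P^A$. For complete $A$ let $S_*(A)$ be the set of types $\mathrm{tp}(\bar c/A)$ of finite tuples $\bar c$ such that $P\cap(A\cup\bar c)=P\cap A$ and $A\cup\bar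 c$ is complete. A complete set $A$ is *stable over $P$* if $|S_*(A')|\le|A'|^{|T|}$ for every set $A'$ elementarily equivalent to $A$ (as structures), where $|T|=|L|+\aleph_0$. The theory $T$ is *fully stable over $P$* if every complete set is stable over $P$; for $N\models T^P$, $T$ is *fully stable over $N$* if every complete set $A$ with $P^A=N$ is stable over $P$. A set $A$ has the *existence property* if there is a model $M\models T$ with $A\subseteq M$ and $P^M=P^A$. The theory $T$ has *full existence* (respectively, *full existence over $N$*) if every complete set $A$ (respectively, every complete $A$ with $P^A=N$) has the existence property. It has the *Gaifman property* if every model of $T^P$ is the $P$-part of some model of $T$. A type $p(\bar x)$ over a set $X$ is *locally isolated* if for every formula $\varphi(\bar x,\bar y)$ some single formula $\theta\in p$ implies every formula in $p$ of the form $\varphi(\bar x,\bar b)$ or $\neg\varphi(\bar x,\bar b)$ with $\bar b$ in $X$; it is *$\aleph_1$-isolated* if it is implied by a countable subset of itself. A model $M\supseteq A$ is *locally constructible* (respectively *$\aleph_1$-constructible*) over $A$ if $M=A\cup\{d_i:i<\alpha\}$ for some ordinal $\alpha$ and some sequence $(d_i)_{i<\alpha}$ such that $\mathrm{tp}(d_i/A\cup\{d_j:j<i\})$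 is locally isolated (respectively $\aleph_1$-isolated) for every $i<\alpha$. **Theorem.** 1. Let $N\models T^P$ and assume that $T$ is fully stable over $N$. Then $T$ has full existence over $N$. More precisely, for every complete set $A$ with $P^A=N$ there is a model $M\models T$ with $A\subseteq M$, $P^M=P^A$ and $|M|\le|A|+\aleph_0$, such that $M$ is locally constructible over $A$ and $\aleph_1$-constructible over $A$. 2. If $T$ is fully stable over $P$, then $T$ has full existence and the Gaifman property. -/

import Mathlib

universe u v w

open FirstOrder FirstOrder.Language Cardinal

namespace OverPredicate

variable {L : FirstOrder.Language.{u, v}}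

/-! The monster model is replaced by the class of all models of the complete theory `T`:
a "set" is a subset of a model of `T`, passing to elementary extensions plays the role of
realising types in the monster model, and two sets living in different models are compared by
elementary maps. -/

/-! ### Subsets as structures -/

/-- The predicates of `L`, without the function (constant) symbols. -/
def predLang (L : FirstOrder.Language.{u, v}) : FirstOrder.Language.{0, v} :=
  ⟨fun _ => Empty, L.Relations⟩

/-- The inclusion of the predicates of `L` in `L`. -/
def predHom (L : FirstOrder.Language.{u, v}) : predLang L →ᴸ L where
  onFunction := fun _ f => nomatch f
  onRelation := fun _ R => R

/-- Every subset `A` of an `L`-structure is regarded as a structure for the predicates of `L`,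
by restriction. -/
instance inducedStructure {M : Type w} [L.Structure M] (A : Set M) :
    (predLang L).Structure A where
  funMap := fun f _ => nomatch f
  RelMap := fun {n} (R : L.Relations n) x => Structure.RelMap (M := M) R (fun i => (x i : M))

/-- The set `P^M` of all elements of `M` that satisfy the monadic predicate `P`. -/
def predSet (P : L.Relations 1) (M : Type w) [L.Structure M] : Set M :=
  {x | Structure.RelMap P ![x]}

/-- `T^P`, the theory of the substructure `P^M` for models `M` of `T`. -/
def theoryOfP (T : L.Theory) (P : L.Relations 1) : (predLang L).Theory :=
  {φ | ∀ M : Theory.ModelType.{u, v, w} T, (predSet P M) ⊨ φ}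

/-! ### Standing hypotheses -/

/-- The standing hypotheses on a theory `T` with a distinguished monadic predicate `P`. -/
structure StandingHypotheses (T : L.Theory) (P : L.Relations 1) : Prop where
  /-- `T` is a complete (in particular consistent) theory. -/
  complete : T.IsComplete
  /-- The vocabulary has no function symbols, except possibly constant symbols. -/
  noFunctions : ∀ n, IsEmpty (L.Functions (n + 1))
  /-- `T` implies that `P` is infinite. -/
  infinite : ∀ M : Theory.ModelType.{u, v, w} T, (predSet P M).Infinite
  /-- `P` is stably embedded: every subset of (a power of) `P` that is definable with parameters
  is definable with parameters in `P`. -/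
  stablyEmbedded : ∀ (M : Theory.ModelType.{u, v, w} T) (n : ℕ) (s : Set (Fin n → M)),
    (∀ x ∈ s, ∀ i, x i ∈ predSet P M) →
      (Set.univ : Set M).Definable L s → (predSet P M).Definable L s
  /-- Quantifier elimination down to the predicates: modulo `T`, every formula is equivalent to
  a quantifier-free formula in the predicates (for example to a single predicate). -/
  quantifierElimination : ∀ (n : ℕ) (φ : L.Formula (Fin n)),
    ∃ θ : (predLang L).Formula (Fin n), θ.IsQF ∧ T.Iff φ ((predHom L).onFormula θ)

/-! ### Completeness, types and stability over `P` -/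

/-- `A ⊆ M` is complete: whenever `∃ x ∈ P, ψ(x, b)` holds with `b` in `A`, a witness `x` can be
found in `P ∩ A` (here `x` and `b` are finite tuples). -/
def IsCompleteSet (P : L.Relations 1) {M : Type w} [L.Structure M] (A : Set M) : Prop :=
  ∀ (m n : ℕ) (ψ : L.Formula (Fin m ⊕ Fin n)) (b : Fin n → M), (∀ i, b i ∈ A) →
    (∃ x : Fin m → M, (∀ i, x i ∈ predSet P M) ∧ ψ.Realize (Sum.elim x b)) →
      ∃ x : Fin m → M, (∀ i, x i ∈ A ∩ predSet P M) ∧ ψ.Realize (Sum.elim x b)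

/-- The set of formulas with parameters in `A` true of `c`, where `c` is a tuple in a structure
`N` in which the elements of `A` are interpreted through `f`. -/
def typeVia {M N : Type w} [L.Structure N] (A : Set M) (f : M → N) {n : ℕ}
    (c : Fin n → N) : Set (L.Formula (A ⊕ Fin n)) :=
  {φ | φ.Realize (Sum.elim (fun a : A => f a) c)}

/-- The complete type `tp(c/A)` of a tuple `c` of `M` over `A ⊆ M`. -/
def typeOver {M : Type w} [L.Structure M] (A : Set M) {n : ℕ} (c : Fin n → M) :
    Set (L.Formula (A ⊕ Fin n)) :=
  typeVia A id c

/-- `S_*(A)`: the types over `A` of finite tuples `c` (in elementary extensions) such that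
`P ∩ (A ∪ c) = P ∩ A` and `A ∪ c` is complete. -/
def starTypes (P : L.Relations 1) {M : Type w} [L.Structure M] (A : Set M) :
    Set (Σ n : ℕ, Set (L.Formula (A ⊕ Fin n))) :=
  {p | ∃ (N : Type w) (_ : L.Structure N) (f : M ↪ₑ[L] N) (c : Fin p.1 → N),
    predSet P N ∩ (f '' A ∪ Set.range c) = predSet P N ∩ f '' A ∧
    IsCompleteSet P (f '' A ∪ Set.range c) ∧
    p.2 = typeVia A f c}

/-- A (complete) set `A` is stable over `P` if `|S_*(B)| ≤ |B| ^ |T|` for all sets `B` that are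
elementarily equivalent to `A`; here `|T|` is the number of formulas, `ℵ₀ + |L|`. -/
def IsStableSet (T : L.Theory) (P : L.Relations 1) {M : Type w} [L.Structure M]
    (A : Set M) : Prop :=
  ∀ (M₁ : Theory.ModelType.{u, v, w} T) (B : Set M₁), B ≅[predLang L] A →
    #(starTypes P B) ≤
      Cardinal.lift.{max u v} #B ^ Cardinal.lift.{w} (max ℵ₀ L.card)

/-- `T` is fully stable over `P`: every complete set is stable over `P`. -/
def FullyStable (T : L.Theory) (P : L.Relations 1) : Prop :=
  ∀ (M : Theory.ModelType.{u, v, w} T) (A : Set M), IsCompleteSet P A → IsStableSet T P A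

/-- The structure `N` is, up to isomorphism, the `P`-part `P^A` of `A ⊆ M`. -/
def HasPPart (P : L.Relations 1) (N : Type w) [(predLang L).Structure N] {M : Type w}
    [L.Structure M] (A : Set M) : Prop :=
  Nonempty (N ≃[predLang L] (A ∩ predSet P M : Set M))

/-- `T` is fully stable over `N`: every complete set `A` with `P^A = N` is stable over `P`. -/
def FullyStableOver (T : L.Theory) (P : L.Relations 1) (N : Type w)
    [(predLang L).Structure N] : Prop :=
  ∀ (M : Theory.ModelType.{u, v, w} T) (A : Set M),
    IsCompleteSet P A → HasPPart P N A → IsStableSet T P A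

/-! ### The existence property -/

/-- `j : A → M` is an elementary map, that is, it preserves the types of finite tuples. Through
such a map `A` is regarded as a subset of `M`. -/
def IsElementaryMap {M₀ M : Type w} [L.Structure M₀] [L.Structure M] (A : Set M₀)
    (j : A → M) : Prop :=
  ∀ (n : ℕ) (φ : L.Formula (Fin n)) (a : Fin n → A),
    φ.Realize (fun i => j (a i)) ↔ φ.Realize (fun i => (a i : M₀))

/-- The elementary map `j : A → M` exhibits `M` as an extension of `A` with `P^M = P^A`. -/
def ExtendsWithSameP (P : L.Relations 1) {M₀ M : Type w} [L.Structure M₀] [L.Structure M]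
    (A : Set M₀) (j : A → M) : Prop :=
  IsElementaryMap (L := L) A j ∧ predSet P M = j '' {a : A | (a : M₀) ∈ predSet P M₀}

/-- `A` has the existence property over `P`: there is a model `M` of `T` with `A ⊆ M` and
`P^M = P^A`. -/
def ExistenceProperty (T : L.Theory) (P : L.Relations 1) {M₀ : Type w} [L.Structure M₀]
    (A : Set M₀) : Prop :=
  ∃ (M : Theory.ModelType.{u, v, w} T) (j : A → M), ExtendsWithSameP P A j

/-- `T` has the full existence property: every complete set has the existence property. -/
def FullExistence (T : L.Theory) (P : L.Relations 1) : Prop :=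
  ∀ (M₀ : Theory.ModelType.{u, v, w} T) (A : Set M₀),
    IsCompleteSet P A → ExistenceProperty T P A

/-- `T` has full existence over `N`: every complete set `A` with `P^A = N` has the existence
property. -/
def FullExistenceOver (T : L.Theory) (P : L.Relations 1) (N : Type w)
    [(predLang L).Structure N] : Prop :=
  ∀ (M₀ : Theory.ModelType.{u, v, w} T) (A : Set M₀),
    IsCompleteSet P A → HasPPart P N A → ExistenceProperty T P A

/-- The Gaifman property: every model of `T^P` is the `P`-part of some model of `T`. -/
def GaifmanProperty (T : L.Theory) (P : L.Relations 1) : Prop :=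
  ∀ (N : Type w) [(predLang L).Structure N], N ⊨ theoryOfP.{u, v, w} T P →
    ∃ M : Theory.ModelType.{u, v, w} T, Nonempty (N ≃[predLang L] predSet P M)

/-! ### Isolation and constructibility -/

section Isolation

variable {M : Type w} [L.Structure M]

/-- `r ⊢ p` for sets of formulas over `X ⊆ M`: in every elementary extension of `M`, every
realisation of `r` realises `p`. -/
def Implies (X : Set M) {n : ℕ} (r p : Set (L.Formula (X ⊕ Fin n))) : Prop :=
  ∀ (N : Type w) [L.Structure N] (f : M ↪ₑ[L] N) (c : Fin n → N),
    r ⊆ typeVia X f c → p ⊆ typeVia X f c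

/-- The formula `φ(x, b)` over `X`, for a formula `φ(x, y)` and a tuple `b` in `X`. -/
def inst (X : Set M) {n m : ℕ} (φ : L.Formula (Fin n ⊕ Fin m)) (b : Fin m → X) :
    L.Formula (X ⊕ Fin n) :=
  φ.relabel (Sum.elim Sum.inr fun i => Sum.inl (b i))

/-- The restriction of `p` to a `φ`-type: the formulas `φ(x, b)` and `¬ φ(x, b)` in `p`. -/
def restrictTo (X : Set M) {n m : ℕ} (p : Set (L.Formula (X ⊕ Fin n)))
    (φ : L.Formula (Fin n ⊕ Fin m)) : Set (L.Formula (X ⊕ Fin n)) :=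
  {ψ ∈ p | ∃ b : Fin m → X, ψ = inst X φ b ∨ ψ = (inst X φ b).not}

/-- `p` is locally isolated: for every formula `φ(x, y)`, the restriction of `p` to a `φ`-type is
implied by a single formula of `p`. -/
def IsLocallyIsolated (X : Set M) {n : ℕ} (p : Set (L.Formula (X ⊕ Fin n))) : Prop :=
  ∀ (m : ℕ) (φ : L.Formula (Fin n ⊕ Fin m)), ∃ θ ∈ p, Implies X {θ} (restrictTo X p φ)

/-- `p` is `κ`-isolated: it is equivalent to a subset of cardinality less than `κ`. -/
def IsIsolatedBelow (κ : Cardinal.{max u v w}) (X : Set M) {n : ℕ}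
    (p : Set (L.Formula (X ⊕ Fin n))) : Prop :=
  ∃ r ⊆ p, #r < κ ∧ Implies X r p

/-- `C` is locally constructible over `B`: `C = B ∪ {d_i : i < α}` for a sequence `d` such that
each `tp(d_i / B ∪ {d_j : j < i})` is locally isolated. -/
def LocallyConstructible (L : FirstOrder.Language.{u, v}) {M : Type w} [L.Structure M]
    (B C : Set M) : Prop :=
  ∃ (α : Ordinal.{w}) (d : Set.Iio α → M), C = B ∪ Set.range d ∧
    ∀ i, IsLocallyIsolated (L := L) (B ∪ d '' Set.Iio i) (typeOver (B ∪ d '' Set.Iio i) ![d i])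

/-- `C` is `κ`-constructible over `B`: `C = B ∪ {d_i : i < α}` for a sequence `d` such that each
`tp(d_i / B ∪ {d_j : j < i})` is `κ`-isolated. -/
def ConstructibleBelow (L : FirstOrder.Language.{u, v}) (κ : Cardinal.{max u v w}) {M : Type w}
    [L.Structure M] (B C : Set M) : Prop :=
  ∃ (α : Ordinal.{w}) (d : Set.Iio α → M), C = B ∪ Set.range d ∧
    ∀ i, IsIsolatedBelow (L := L) κ (B ∪ d '' Set.Iio i)
      (typeOver (B ∪ d '' Set.Iio i) ![d i])

end Isolation

end OverPredicate

namespace OverPredicate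

variable {L : FirstOrder.Language.{u, v}}

/-! Let `A` be complete, and let every complete extension of `A` with the same `P`-part be stable.
Inside a countably saturated extension of the ambient model, elements are added to `A` one at a
time, each locally isolated over what precedes it, until the Tarski–Vaught test holds. Such steps
never enlarge `P`.

The heart is a density statement, `exists_deciding`: over a complete stable set, every nonempty
definable set contains a nonempty definable set on which all instances of a given `φ` are decided.
Otherwise instances of `φ` split every nonempty definable subset of some definable set, and a binary
tree of such instances can be grown. Its height is the least cardinal `μ` with `2 ^ μ` above the
continuum, so there are at most continuum many nodes but more branches. The branches must yield
types in `S_*(B)` for some `B` elementarily equivalent to `A`; therefore names for `P`-witnesses and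
for Henkin witnesses are added at every level. Finitely many requirements can be met in the given
model, level by level (`exists_branchReq`, `exists_levelReq`), and an ultrapower meets all of them
at once (`exists_large_family`). Then `S_*(B)` is larger than `continuum ^ ℵ₀ = continuum`, against
stability.

Since the vocabulary is countable, countably many applications of density and saturation give
locally isolated elements in every nonempty definable set (`exists_locallyIsolatedAt`). Adding one
keeps the set complete (`LocallyIsolatedAt.witnessedBy`), so the hypothesis applies again, and a
recursion of length `#A + ℵ₀` with bookkeeping produces the model (`exists_construction`,
`exists_constructible_model`).

For the Gaifman property, compactness embeds a model of `T^P` elementarily into an ultraproduct of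
`P`-parts. Quantifier elimination makes the image a complete set (`exists_complete_copy`), and full
existence supplies a model around it. -/

/-- Every formula depends on only finitely many of its free variables in `α`. -/
theorem exists_finite_support {α β : Type*} (φ : L.Formula (α ⊕ β)) :
    ∃ (n : ℕ) (a : Fin n → α) (φ' : L.Formula (Fin n ⊕ β)), Function.Injective a ∧
      ∀ (M : Type w) [L.Structure M] (f : α → M) (g : β → M),
        φ'.Realize (Sum.elim (f ∘ a) g) ↔ φ.Realize (Sum.elim f g) := by
  classical
  let s : Finset α := φ.freeVarFinset.toLeft
  let e := s.equivFin
  have key : ∀ x ∈ φ.freeVarFinset, ∀ a, x = Sum.inl a → a ∈ s := by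
    rintro x hx a rfl
    simpa [s] using hx
  let r : φ.freeVarFinset → Fin s.card ⊕ β := fun x =>
    match h : x.1 with
    | Sum.inl a => Sum.inl (e ⟨a, key x.1 x.2 a h⟩)
    | Sum.inr b => Sum.inr b
  refine ⟨s.card, fun i => (e.symm i : α), φ.restrictFreeVar r,
    fun i j h => e.symm.injective (Subtype.ext h), fun M _ f g => ?_⟩
  refine BoundedFormula.realize_restrictFreeVar _ ?_
  rintro ⟨x | x, hx⟩ <;> simp [r]

/-! ### Witnesses in `P` -/

section ExistsInPredicate

variable {M : Type w} [L.Structure M]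

/-- The formula `∃ x ∈ P, ψ(x, y)`. -/
noncomputable def exIn (P : L.Relations 1) {γ : Type*} {m : ℕ} (ψ : L.Formula (Fin m ⊕ γ)) :
    L.Formula γ :=
  Formula.iExs (Fin m) (ψ.relabel Sum.swap ⊓
    Formula.iInf fun i : Fin m => P.formula₁ (Term.var (Sum.inr i)))

theorem realize_exIn (P : L.Relations 1) {γ : Type*} {m : ℕ} (ψ : L.Formula (Fin m ⊕ γ))
    (v : γ → M) :
    (exIn P ψ).Realize v ↔
      ∃ x : Fin m → M, (∀ i, x i ∈ predSet P M) ∧ ψ.Realize (Sum.elim x v) := by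
  rw [exIn, Formula.realize_iExs]
  refine exists_congr fun x => ?_
  rw [Formula.realize_inf, Formula.realize_iInf, Formula.realize_relabel, and_comm]
  have : Sum.elim v x ∘ Sum.swap = Sum.elim x v := by
    funext i; cases i <;> rfl
  have hv : ∀ i, (fun _ : Fin 1 => x i) = ![x i] := fun i => by
    funext j; fin_cases j; rfl
  simp [this, predSet, Relations.formula₁, hv]

/-- Existential statements over `B` about tuples in `P` have witnesses in `P ∩ A`. -/
def WitnessedBy (P : L.Relations 1) (A B : Set M) : Prop :=
  ∀ (m n : ℕ) (ψ : L.Formula (Fin m ⊕ Fin n)) (b : Fin n → M), (∀ i, b i ∈ B) →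
    (∃ x : Fin m → M, (∀ i, x i ∈ predSet P M) ∧ ψ.Realize (Sum.elim x b)) →
      ∃ x : Fin m → M, (∀ i, x i ∈ A ∩ predSet P M) ∧ ψ.Realize (Sum.elim x b)

/-- A formula mentions only finitely many variables, so the restriction to finite parameter tuples
is harmless. This allows all of a set to be used as parameters at once. -/
theorem WitnessedBy.exists_of_formula {P : L.Relations 1} {A B : Set M} (h : WitnessedBy P A B)
    {γ : Type*} {m : ℕ} (ψ : L.Formula (Fin m ⊕ γ)) {v : γ → M} (hv : ∀ i, v i ∈ B)
    {x : Fin m → M} (hx : ∀ i, x i ∈ predSet P M) (hψ : ψ.Realize (Sum.elim x v)) :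
    ∃ x : Fin m → M, (∀ i, x i ∈ A ∩ predSet P M) ∧ ψ.Realize (Sum.elim x v) := by
  obtain ⟨n, a, φ, -, hφ⟩ := exists_finite_support.{u, v, w} (ψ.relabel Sum.swap)
  have hsw : ∀ y : Fin m → M, (φ.relabel Sum.swap).Realize (Sum.elim y (v ∘ a)) ↔
      ψ.Realize (Sum.elim y v) := fun y => by
    have h1 : Sum.elim y (v ∘ a) ∘ Sum.swap = Sum.elim (v ∘ a) y := by
      funext i; cases i <;> rfl
    have h2 : Sum.elim v y ∘ Sum.swap = Sum.elim y v := by funext i; cases i <;> rfl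
    rw [Formula.realize_relabel, h1, hφ, Formula.realize_relabel, h2]
  obtain ⟨y, hy, hy'⟩ := h m n (φ.relabel Sum.swap) (v ∘ a) (fun i => hv _) ⟨x, hx, (hsw x).2 hψ⟩
  exact ⟨y, hy, (hsw y).1 hy'⟩

/-- For `b` in `P`, the formula `x = b` has only the witness `b`, which must therefore lie in `A`.
So being witnessed already forbids new elements of `P`. -/
theorem WitnessedBy.inter_subset {P : L.Relations 1} {A B : Set M} (h : WitnessedBy P A B) :
    B ∩ predSet P M ⊆ A := by
  rintro b ⟨hb, hP⟩
  obtain ⟨x, hx, hxb⟩ := h 1 1 ((Term.var (Sum.inl 0)).equal (Term.var (Sum.inr 0))) ![b]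
    (by simpa using hb) ⟨![b], by simpa using hP, by simp⟩
  simp only [Formula.realize_equal, Term.realize_var, Sum.elim_inl, Sum.elim_inr] at hxb
  have := (hx 0).1
  rw [hxb] at this
  simpa using this

theorem WitnessedBy.isCompleteSet {P : L.Relations 1} {A B : Set M} (h : WitnessedBy P A B)
    (hAB : A ⊆ B) : IsCompleteSet P B := fun m n ψ b hb hx =>
  let ⟨x, hx, hψ⟩ := h m n ψ b hb hx
  ⟨x, fun i => ⟨hAB (hx i).1, (hx i).2⟩, hψ⟩

/-- Used to chain successive extensions: witnesses found in the previous stage lie in the initial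
set, because `P` has not grown there. -/
theorem WitnessedBy.union_subset {P : L.Relations 1} {A A' B : Set M} (h : WitnessedBy P A' B)
    (hA : A' ∩ predSet P M ⊆ A) : WitnessedBy P A B := fun m n ψ b hb hx =>
  let ⟨x, hx, hψ⟩ := h m n ψ b hb hx
  ⟨x, fun i => ⟨hA (hx i), (hx i).2⟩, hψ⟩

end ExistsInPredicate

/-! ### Sets definable over parameters -/

section Definable

variable {M : Type w} [L.Structure M]

/-- `X ⊆ M` is defined by a formula with parameters in `A`. -/
def DefinedOver (L : FirstOrder.Language.{u, v}) {M : Type w} [L.Structure M] (A X : Set M) :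
    Prop :=
  ∃ θ : L.Formula (A ⊕ Fin 1), ∀ c, c ∈ X ↔ θ.Realize (Sum.elim (fun a : A => (a : M)) ![c])

theorem DefinedOver.of_formula {A : Set M} {γ : Type*} (φ : L.Formula (γ ⊕ Fin 1)) {v : γ → M}
    (hv : ∀ i, v i ∈ A) : DefinedOver L A {c | φ.Realize (Sum.elim v ![c])} := by
  refine ⟨φ.relabel (Sum.map (fun i => ⟨v i, hv i⟩) id), fun c => ?_⟩
  rw [Formula.realize_relabel, Sum.elim_comp_map]
  rfl

theorem DefinedOver.univ {A : Set M} : DefinedOver L A Set.univ :=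
  ⟨⊤, fun c => by simp [Formula.Realize]⟩

theorem DefinedOver.inter {A X Y : Set M} (hX : DefinedOver L A X) (hY : DefinedOver L A Y) :
    DefinedOver L A (X ∩ Y) := by
  obtain ⟨θ, hθ⟩ := hX
  obtain ⟨χ, hχ⟩ := hY
  exact ⟨θ ⊓ χ, fun c => by rw [Formula.realize_inf, Set.mem_inter_iff, hθ, hχ]⟩

theorem DefinedOver.compl {A X : Set M} (hX : DefinedOver L A X) : DefinedOver L A Xᶜ := by
  obtain ⟨θ, hθ⟩ := hX
  exact ⟨θ.not, fun c => by rw [Formula.realize_not, Set.mem_compl_iff, hθ]⟩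

theorem DefinedOver.mono {A B X : Set M} (hX : DefinedOver L A X) (h : A ⊆ B) :
    DefinedOver L B X := by
  obtain ⟨θ, hθ⟩ := hX
  convert! DefinedOver.of_formula (A := B) θ (v := fun a : A => (a : M)) (fun i => h i.2)
  ext c; exact hθ c

/-- In a complete set, `∃ x ∈ P, ∃ c ∈ X, ψ(x, c, d)` is witnessed by some `x` in the set. -/
theorem exists_witness {P : L.Relations 1} {A X : Set M} (hA : IsCompleteSet P A)
    (hX : DefinedOver L A X) {m n : ℕ} (ψ : L.Formula (Fin m ⊕ (Fin n ⊕ Fin 1))) {d : Fin n → M}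
    (hd : ∀ i, d i ∈ A) {x : Fin m → M} (hx : ∀ i, x i ∈ predSet P M) {c : M} (hc : c ∈ X)
    (hψ : ψ.Realize (Sum.elim x (Sum.elim d ![c]))) :
    ∃ x : Fin m → M, (∀ i, x i ∈ A ∩ predSet P M) ∧
      ∃ c ∈ X, ψ.Realize (Sum.elim x (Sum.elim d ![c])) := by
  obtain ⟨θ, hθ⟩ := hX
  -- Quantifying out `c` leaves a formula with parameters in `A` only, so completeness applies; the
  -- price is that `c` may be replaced by another element of `X`.
  let Φ : L.Formula (Fin m ⊕ (A ⊕ Fin n)) := Formula.iExs (Fin 1)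
    ((θ.relabel (Sum.elim (fun a => Sum.inl (Sum.inr (Sum.inl a))) Sum.inr) ⊓
      ψ.relabel (Sum.elim (fun i => Sum.inl (Sum.inl i))
        (Sum.elim (fun i => Sum.inl (Sum.inr (Sum.inr i))) Sum.inr)) :
        L.Formula ((Fin m ⊕ (A ⊕ Fin n)) ⊕ Fin 1)))
  have hΦ : ∀ y : Fin m → M, Φ.Realize (Sum.elim y (Sum.elim (fun a : A => (a : M)) d)) ↔
      ∃ c ∈ X, ψ.Realize (Sum.elim y (Sum.elim d ![c])) := fun y => by
    simp only [Φ, Formula.realize_iExs, Formula.realize_inf, Formula.realize_relabel]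
    have h1 : ∀ c : Fin 1 → M, Sum.elim (Sum.elim y (Sum.elim (fun a : A => (a : M)) d)) c ∘
        (Sum.elim (fun a => Sum.inl (Sum.inr (Sum.inl a))) Sum.inr) =
        Sum.elim (fun a : A => (a : M)) c := fun c => by
      funext i; rcases i with i | i <;> rfl
    have h2 : ∀ c : Fin 1 → M, Sum.elim (Sum.elim y (Sum.elim (fun a : A => (a : M)) d)) c ∘
        (Sum.elim (fun i => Sum.inl (Sum.inl i))
        (Sum.elim (fun i => Sum.inl (Sum.inr (Sum.inr i))) Sum.inr)) =
        Sum.elim y (Sum.elim d c) := fun c => by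
      funext i; rcases i with i | i | i <;> rfl
    simp only [h1, h2]
    constructor
    · rintro ⟨c, hc⟩
      have hc0 : c = ![c 0] := by funext i; fin_cases i; rfl
      rw [hc0] at hc
      exact ⟨c 0, (hθ _).2 hc.1, hc.2⟩
    · rintro ⟨c, hc⟩
      exact ⟨![c], (hθ _).1 hc.1, hc.2⟩
  obtain ⟨y, hy, hy'⟩ := WitnessedBy.exists_of_formula (B := A) hA Φ
    (v := Sum.elim (fun a : A => (a : M)) d)
    (by rintro (i | i); exacts [i.2, hd i]) hx ((hΦ x).2 ⟨c, hc, hψ⟩)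
  exact ⟨y, hy, (hΦ y).1 hy'⟩

end Definable

/-! ### Tree-like families of requirements -/

section Tree

/-- The nodes of the binary tree whose levels are indexed by `W`. -/
abbrev Node (W : Type w) [Preorder W] : Type w := Σ w : W, Set.Iio w → Bool

/-- The node at level `w` on the branch `η`. -/
def node {W : Type w} [Preorder W] (η : W → Bool) (w : W) : Node W := ⟨w, fun u => η u⟩

/-- Names for parameters: one for each node of the tree, and `Λ` many for each level. -/
abbrev ParamName (W Λ : Type w) [Preorder W] : Type w := Node W ⊕ (W × Λ)

/-- The level of a name. -/
def ParamName.level {W Λ : Type w} [Preorder W] : ParamName W Λ → W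
  | Sum.inl ν => ν.1
  | Sum.inr k => k.1

variable {W Λ : Type w} [LinearOrder W] {V M : Type*}

/-- The condition imposed on the elements of the branch `η` by a name. -/
def branchReq (Sp : V → Set M) (R : W × Λ → (W → Bool) → (ParamName W Λ → V) → V → Set M)
    (η : W → Bool) (val : ParamName W Λ → V) : ParamName W Λ → Set M
  | Sum.inl ν => {c | ν = node η ν.1 → (c ∈ Sp (val (Sum.inl ν)) ↔ η ν.1 = true)}
  | Sum.inr k => R k η val (val (Sum.inr k))

theorem node_eq_of_agree {w : W} {η η' : W → Bool} (h : ∀ u < w, η u = η' u) :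
    node η w = node η' w := by
  simp only [node]
  congr 1
  funext u
  exact h u u.2

theorem agree_of_node_eq {w : W} {η η' : W → Bool} (h : node η w = node η' w) :
    ∀ u < w, η u = η' u := by
  intro u hu
  simp only [node, Sigma.mk.injEq, heq_eq_eq, true_and] at h
  exact congrFun h ⟨u, hu⟩

/-- Finitely many requirements on the branches of a tree can be met simultaneously, if every
requirement can be met by a suitable choice of one parameter. -/
theorem exists_branchReq (D : Set (Set M)) (hD : ∀ X ∈ D, ∀ Y ∈ D, X ∩ Y ∈ D)
    (huniv : Set.univ ∈ D) {X₀ : Set M} (hX₀ : X₀ ∈ D) (hne : X₀.Nonempty) [Inhabited V]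
    (Sp : V → Set M) (hSp : ∀ v, Sp v ∈ D) (hSp' : ∀ v, (Sp v)ᶜ ∈ D)
    (hsplit : ∀ X ∈ D, X.Nonempty → X ⊆ X₀ → ∃ v, (X ∩ Sp v).Nonempty ∧ (X ∩ (Sp v)ᶜ).Nonempty)
    (R : W × Λ → (W → Bool) → (ParamName W Λ → V) → V → Set M)
    (hRη : ∀ k η η' val v, (∀ u < k.1, η u = η' u) → R k η val v = R k η' val v)
    (hRval : ∀ k η val val' v, (∀ q : ParamName W Λ, q.level < k.1 → val q = val' q) →
      R k η val v = R k η val' v)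
    (hRD : ∀ k η val v, R k η val v ∈ D)
    (hR : ∀ k val, ∃ ν : Node W, ∀ X ∈ D, X.Nonempty → ∃ v, ∀ η,
      (ν = node η k.1 → (X ∩ R k η val v).Nonempty) ∧
      (ν ≠ node η k.1 → R k η val v = Set.univ))
    (S : Finset (ParamName W Λ)) :
    ∃ val : ParamName W Λ → V, ∀ η : W → Bool,
      (X₀ ∩ ⋂ k ∈ S, branchReq Sp R η val k).Nonempty := by
  classical
  -- Names are treated by increasing level, and within a level the tasks come before the nodes.
  -- Hence when a task is treated, only decisions of strictly lower nodes have been made.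
  let key : ParamName W Λ → W ×ₗ Bool := fun k => toLex (k.level, k.isLeft)
  induction S using Finset.induction_on_max_value key with
  | empty => exact ⟨default, fun η => by simpa using hne⟩
  | insert k s hks hmax ih =>
    obtain ⟨val, hval⟩ := ih
    have hlev : ∀ q ∈ s, q.level ≤ k.level := fun q hq => by
      have := hmax q hq
      rw [Prod.Lex.toLex_le_toLex] at this
      rcases this with h | h
      exacts [h.le, h.1.le]
    -- Earlier requirements read only their own value and values of lower levels, so the new value
    -- does not disturb them.
    have hupd : ∀ v η, ∀ q ∈ s,
        branchReq Sp R η (Function.update val k v) q = branchReq Sp R η val q := by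
      intro v η q hq
      have hqk : q ≠ k := fun h => hks (h ▸ hq)
      cases q with
      | inl ν => simp only [branchReq, Function.update_of_ne hqk]
      | inr q =>
        simp only [branchReq, Function.update_of_ne hqk]
        refine hRval _ _ _ _ _ fun q' hq' => Function.update_of_ne ?_ _ _
        rintro rfl
        exact absurd (hlev _ hq) (not_le.2 hq')
    let X : (W → Bool) → Set M := fun η => X₀ ∩ ⋂ q ∈ s, branchReq Sp R η val q
    have hreqD : ∀ η val q, branchReq Sp R η val q ∈ D := by
      intro η val q
      cases q with
      | inl ν =>
        by_cases h1 : ν = node η ν.1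
        · cases h2 : η ν.1
          · convert hSp' (val (Sum.inl ν)) using 1
            ext c; simp [branchReq, ← h1, h2]
          · convert hSp (val (Sum.inl ν)) using 1
            ext c; simp [branchReq, ← h1, h2]
        · convert huniv using 1
          ext c; simp [branchReq, h1]
      | inr q => exact hRD _ _ _ _
    have hXD : ∀ η, X η ∈ D := by
      intro η
      refine hD _ hX₀ _ ?_
      clear hval hupd hlev hks hmax
      induction s using Finset.induction_on with
      | empty => simpa using huniv
      | insert a t _ iht =>
        rw [Finset.set_biInter_insert]
        exact hD _ (hreqD _ _ _) _ iht
    -- The set still available to a branch depends only on the node where the branch reaches the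
    -- current level. One choice of value can therefore serve all branches through that node.
    have hXeq : ∀ η η', node η k.level = node η' k.level →
        (∀ ν, k = Sum.inl ν → ν = node η k.level) → X η = X η' := by
      intro η η' hnode hk
      have hag := agree_of_node_eq hnode
      have : ∀ q ∈ s, branchReq Sp R η val q = branchReq Sp R η' val q := by
        intro q hq
        cases q with
        | inr q => exact hRη _ _ _ _ _ fun u hu => hag u (hu.trans_le (hlev _ hq))
        | inl ν =>
          rcases (hlev _ hq).lt_or_eq with hlt | heq
          · have h1 : node η ν.1 = node η' ν.1 :=
              node_eq_of_agree fun u hu => hag u (hu.trans hlt)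
            simp only [branchReq, h1, hag ν.1 hlt]
          -- A different node of the same level says nothing about branches through the current one;
          -- if the current name is a task, the order excludes such a node.
          · change ν.1 = k.level at heq
            cases k with
            | inl ν' =>
              have hne' : ν ≠ node η ν.1 := by
                intro h
                rw [heq, ← hk ν' rfl] at h
                exact hks (h ▸ hq)
              have hne'' : ν ≠ node η' ν.1 := by
                rw [heq, ← hnode, ← heq]; exact hne'
              ext c; simp [branchReq, hne', hne'']
            | inr k =>
              have := hmax _ hq
              rw [Prod.Lex.toLex_le_toLex] at this
              rcases this with h | h
              · exact absurd heq h.ne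
              · exact absurd h.2 (show ¬ (true ≤ false) by decide)
      simp only [X]
      congr 1
      exact Set.iInter₂_congr this
    have hgoal : ∀ v η, (X η ∩ branchReq Sp R η (Function.update val k v) k).Nonempty →
        (X₀ ∩ ⋂ q ∈ insert k s, branchReq Sp R η (Function.update val k v) q).Nonempty := by
      rintro v η ⟨c, hc, hck⟩
      refine ⟨c, hc.1, ?_⟩
      rw [Finset.set_biInter_insert]
      refine ⟨hck, ?_⟩
      rw [Set.iInter₂_congr (hupd v η)]
      exact hc.2
    have hXne : ∀ η, (X η).Nonempty := hval
    cases k with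
    | inl ν =>
      by_cases hν : ∃ η₀, ν = node η₀ ν.1
      · obtain ⟨η₀, hη₀⟩ := hν
        obtain ⟨v, hv₁, hv₂⟩ := hsplit (X η₀) (hXD _) (hXne _) Set.inter_subset_left
        refine ⟨Function.update val (Sum.inl ν) v, fun η => hgoal v η ?_⟩
        by_cases h : ν = node η ν.1
        · have hX : X η₀ = X η := hXeq η₀ η (hη₀.symm.trans h) fun ν' h' => by
            cases h'; exact hη₀
          rw [hX] at hv₁ hv₂
          cases h2 : η ν.1
          · refine hv₂.mono (Set.inter_subset_inter_right _ fun c hc => ?_)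
            simpa [branchReq, ← h, h2] using hc
          · refine hv₁.mono (Set.inter_subset_inter_right _ fun c hc => ?_)
            simpa [branchReq, ← h, h2] using hc
        · obtain ⟨c, hc⟩ := hXne η
          exact ⟨c, hc, by simp [branchReq, h]⟩
      · refine ⟨Function.update val (Sum.inl ν) default, fun η => hgoal _ η ?_⟩
        obtain ⟨c, hc⟩ := hXne η
        exact ⟨c, hc, by simpa [branchReq] using fun h => (hν ⟨η, h⟩).elim⟩
    | inr k =>
      have hRupd : ∀ v η, branchReq Sp R η (Function.update val (Sum.inr k) v) (Sum.inr k) =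
          R k η val v := by
        intro v η
        simp only [branchReq, Function.update_self]
        refine hRval _ _ _ _ _ fun q hq => Function.update_of_ne ?_ _ _
        rintro rfl
        exact lt_irrefl _ hq
      obtain ⟨ν, hν⟩ := hR k val
      have hfin : ∀ η₀, (∀ η, ν = node η k.1 → X η = X η₀) → ∃ v, ∀ η,
          (X η ∩ R k η val v).Nonempty := by
        intro η₀ hη₀
        obtain ⟨v, hv⟩ := hν (X η₀) (hXD _) (hXne _)
        refine ⟨v, fun η => ?_⟩
        by_cases h : ν = node η k.1
        · rw [hη₀ η h]; exact (hv η).1 h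
        · rw [(hv η).2 h, Set.inter_univ]; exact hXne η
      have : ∃ v, ∀ η, (X η ∩ R k η val v).Nonempty := by
        by_cases hex : ∃ η₀, ν = node η₀ k.1
        · obtain ⟨η₀, hη₀⟩ := hex
          exact hfin η₀ fun η h => hXeq η η₀ (h.symm.trans hη₀) (by simp)
        · exact hfin (fun _ => true) fun η h => (hex ⟨η, h⟩).elim
      obtain ⟨v, hv⟩ := this
      exact ⟨_, fun η => hgoal v η (by rw [hRupd]; exact hv η)⟩

end Tree

/-! ### Ultraproducts -/

section Ultraproduct

variable {I : Type*} {U : Ultrafilter I} {M : I → Type*}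

/-- The class of a sequence in an ultraproduct. -/
def ultraMk (U : Ultrafilter I) (f : ∀ i, M i) : (U : Filter I).Product M := f

theorem ultraMk_surjective : Function.Surjective (ultraMk U : (∀ i, M i) → _) :=
  Quotient.exists_rep

theorem ultraMk_eq_iff {f g : ∀ i, M i} : ultraMk U f = ultraMk U g ↔ ∀ᶠ i in U, f i = g i :=
  Quotient.eq''

variable [∀ i, L.Structure (M i)] [∀ i, Nonempty (M i)]

theorem realize_ultraMk {β : Type*} (φ : L.Formula β) (x : β → ∀ i, M i) :
    φ.Realize (fun b => ultraMk U (x b)) ↔ ∀ᶠ i in U, φ.Realize fun b => x b i :=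
  Ultraproduct.realize_formula_cast φ x

theorem relMap_ultraMk {n : ℕ} (R : L.Relations n) (x : Fin n → ∀ i, M i) :
    Structure.RelMap R (fun b => ultraMk U (x b)) ↔
      ∀ᶠ i in U, Structure.RelMap R fun b => x b i := by
  simpa using realize_ultraMk (U := U) (R.formula fun b => Term.var b) x

theorem ultraMk_mem_predSet (P : L.Relations 1) (f : ∀ i, M i) :
    ultraMk U f ∈ predSet P ((U : Filter I).Product M) ↔ ∀ᶠ i in U, f i ∈ predSet P (M i) := by
  have h := relMap_ultraMk (U := U) P ![f]
  have h1 : (fun b => ultraMk U ((![f] : Fin 1 → ∀ i, M i) b)) = ![ultraMk U f] := by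
    funext j; fin_cases j; rfl
  have h2 : ∀ i, (fun b => (![f] : Fin 1 → ∀ i, M i) b i) = ![f i] := fun i => by
    funext j; fin_cases j; rfl
  rw [h1] at h
  simpa only [predSet, Set.mem_ofPred_eq, h2] using h

theorem ultraproduct_models {T : L.Theory} (h : ∀ i, M i ⊨ T) : (U : Filter I).Product M ⊨ T :=
  ⟨fun φ hφ => (Ultraproduct.sentence_realize φ).2
    (Filter.Eventually.of_forall fun i => (h i).realize_of_mem φ hφ)⟩

end Ultraproduct

/-! ### Cardinals of trees and countability of formulas -/

/-- There is a well-order `W` without last element such that the binary tree of height `W` has at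
most continuum many nodes, but more than continuum many branches. -/
theorem exists_tree_levels : ∃ (W : Type w) (_ : LinearOrder W), WellFoundedLT W ∧ Nonempty W ∧
    NoMaxOrder W ∧ #W ≤ continuum ∧ (∀ x : W, #(Set.Iio x → Bool) ≤ continuum) ∧
      continuum < #(W → Bool) := by
  -- Minimality of the height bounds the number of nodes at each level by the continuum, while the
  -- height itself gives more branches than that.
  let s : Set Cardinal.{w} := {κ | continuum < 2 ^ κ}
  have hs : s.Nonempty := ⟨continuum, cantor _⟩
  let μ := sInf s
  have hμ : continuum < 2 ^ μ := csInf_mem hs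
  have hlt : ∀ κ < μ, (2 : Cardinal.{w}) ^ κ ≤ continuum := fun κ hκ =>
    not_lt.1 fun h => notMem_of_lt_csInf' hκ h
  have hμ0 : ℵ₀ ≤ μ := by
    by_contra! h
    exact absurd hμ (not_lt.2 ((power_lt_aleph0 (natCast_lt_aleph0 (n := 2)) h).le.trans
      aleph0_le_continuum))
  refine ⟨μ.ord.ToType, inferInstance, inferInstance, ?_, ?_, ?_, ?_, ?_⟩
  · rw [← mk_ne_zero_iff, mk_ord_toType]
    exact (aleph0_pos.trans_le hμ0).ne'
  · exact Cardinal.noMaxOrder hμ0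
  · rw [mk_ord_toType]
    exact csInf_le' (cantor _)
  · intro x
    have : #(Set.Iio x) < μ := by simpa using mk_Iio_lt x (by simp)
    simpa using hlt _ this
  · simpa using hμ

theorem countable_formula (hL : L.card ≤ ℵ₀) (α : Type*) [Countable α] (n : ℕ) :
    Countable (L.BoundedFormula α n) := by
  have h : #(Σ n, L.BoundedFormula α n) ≤ ℵ₀ :=
    BoundedFormula.card_le.trans (by simpa using hL)
  have := mk_le_aleph0_iff.1 h
  exact (sigma_mk_injective (β := fun n => L.BoundedFormula α n) (i := n)).countable

theorem card_predLang_le (hL : L.card ≤ ℵ₀) : (predLang L).card ≤ ℵ₀ := by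
  have h : Countable L.Symbols := mk_le_aleph0_iff.1 hL
  have hR : Countable (Σ n, L.Relations n) :=
    Function.Injective.countable (β := L.Symbols) Sum.inr_injective
  have : Countable (predLang L).Symbols :=
    inferInstanceAs (Countable ((Σ _ : ℕ, Empty) ⊕ Σ n, L.Relations n))
  exact mk_le_aleph0_iff.2 this

/-! ### Many types over a set in which every definable set splits -/

section Tasks

variable {M : Type w} [L.Structure M]

/-- A task is either to find witnesses in `P` for a formula about an element of `M`, or to find a
witness for a formula in the structure `A`. -/
abbrev TaskCode (L : FirstOrder.Language.{u, v}) : Type max u v :=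
  (Σ m n : ℕ, L.Formula (Fin m ⊕ (Fin n ⊕ Fin 1))) ⊕
    (Σ n : ℕ, (predLang L).BoundedFormula Empty (n + 1))

theorem exists_taskCode_enumeration (hL : L.card ≤ ℵ₀) :
    ∃ e : ℕ → TaskCode L, Function.Surjective e := by
  have : ∀ m n, Countable (L.Formula (Fin m ⊕ (Fin n ⊕ Fin 1))) := fun m n =>
    countable_formula hL _ _
  have : ∀ n, Countable ((predLang L).BoundedFormula Empty (n + 1)) := fun n =>
    countable_formula (card_predLang_le hL) _ _
  have : Nonempty (TaskCode L) := ⟨Sum.inr ⟨0, ⊤⟩⟩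
  exact exists_surjective_nat _

/-- The elements `c` for which `v` fulfils the task with parameters `p`. -/
def taskReq (P : L.Relations 1) (A : Set M) (thru : Prop) (p v : ℕ → A) : TaskCode L → Set M
  | Sum.inl ⟨m, n, ψ⟩ => {c | thru →
      (∃ y : Fin m → M, (∀ i, y i ∈ predSet P M) ∧
        ψ.Realize (Sum.elim y (Sum.elim (fun i : Fin n => (p i : M)) ![c]))) →
      (∀ i : Fin m, (v i : M) ∈ predSet P M) ∧
        ψ.Realize (Sum.elim (fun i : Fin m => (v i : M))
          (Sum.elim (fun i : Fin n => (p i : M)) ![c]))}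
  | Sum.inr ⟨n, χ⟩ => {_c |
      (∃ a : A, χ.Realize default (Fin.snoc (fun i : Fin n => p i) a)) →
        χ.Realize default (Fin.snoc (fun i : Fin n => p i) (v 0))}

theorem definedOver_const {A : Set M} (p : Prop) : DefinedOver L A {_c | p} := by
  by_cases h : p
  · simpa [h] using DefinedOver.univ (L := L) (A := A)
  · simpa [h] using (DefinedOver.univ (L := L) (A := A)).compl

theorem definedOver_imp {A : Set M} {p q : M → Prop} (hp : DefinedOver L A {c | p c})
    (hq : DefinedOver L A {c | q c}) : DefinedOver L A {c | p c → q c} := by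
  convert! (hp.inter hq.compl).compl
  ext c
  simp

theorem definedOver_taskReq (P : L.Relations 1) (A : Set M) (thru : Prop) (p v : ℕ → A)
    (cd : TaskCode L) : DefinedOver L A (taskReq P A thru p v cd) := by
  rcases cd with ⟨m, n, ψ⟩ | ⟨n, χ⟩
  · refine definedOver_imp (definedOver_const _) (definedOver_imp ?_
      (DefinedOver.inter (definedOver_const _) ?_))
    · convert! DefinedOver.of_formula (A := A) (exIn P ψ) (v := fun i : Fin n => (p i : M))
        (fun i => (p i).2) using 3
      rw [realize_exIn]
    · change DefinedOver L A {c | ψ.Realize (Sum.elim (fun i : Fin m => (v i : M))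
          (Sum.elim (fun i : Fin n => (p i : M)) ![c]))}
      convert! DefinedOver.of_formula (A := A)
        (ψ.relabel (Sum.elim (fun i => Sum.inl (Sum.inl i))
          (Sum.elim (fun i => Sum.inl (Sum.inr i)) Sum.inr)) :
            L.Formula ((Fin m ⊕ Fin n) ⊕ Fin 1))
        (v := Sum.elim (fun i : Fin m => (v i : M)) fun i : Fin n => (p i : M))
        (by rintro (i | i); exacts [(v i).2, (p i).2]) using 3
      rw [Formula.realize_relabel]
      refine iff_of_eq (congrArg _ ?_)
      funext i; rcases i with i | i | i <;> rfl
  · exact definedOver_const _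

/-- If some element of `X` has a witness in `P`, then `exists_witness` gives one in `A`, good for a
possibly different element of `X`. If none has, the task is vacuous on `X`. Henkin tasks do not
involve the element at all. -/
theorem exists_taskReq (P : L.Relations 1) {A : Set M} (hA : IsCompleteSet P A)
    (a₀ : A) (p : ℕ → A) (cd : TaskCode L) {X : Set M} (hX : DefinedOver L A X)
    (hne : X.Nonempty) : ∃ v : ℕ → A, (∀ thru, (X ∩ taskReq P A thru p v cd).Nonempty) ∧
      taskReq P A False p v cd = Set.univ := by
  obtain ⟨c₀, hc₀⟩ := hne
  rcases cd with ⟨m, n, ψ⟩ | ⟨n, χ⟩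
  · by_cases h : ∃ c ∈ X, ∃ y : Fin m → M, (∀ i, y i ∈ predSet P M) ∧
        ψ.Realize (Sum.elim y (Sum.elim (fun i : Fin n => (p i : M)) ![c]))
    · obtain ⟨c, hc, y, hy, hψ⟩ := h
      obtain ⟨b, hb, c', hc', hψ'⟩ := exists_witness hA hX ψ (fun i => (p i).2) hy hc hψ
      refine ⟨fun i => if hi : i < m then ⟨b ⟨i, hi⟩, (hb _).1⟩ else a₀, fun thru =>
        ⟨c', hc', fun _ _ => ⟨fun i => by simpa using (hb i).2, by simpa using hψ'⟩⟩, ?_⟩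
      exact Set.eq_univ_of_forall fun c h => h.elim
    · exact ⟨fun _ => a₀, fun thru => ⟨c₀, hc₀, fun _ h' => (h ⟨c₀, hc₀, h'⟩).elim⟩,
        Set.eq_univ_of_forall fun c h => h.elim⟩
  · by_cases h : ∃ a : A, χ.Realize default (Fin.snoc (fun i : Fin n => p i) a)
    · obtain ⟨a, ha⟩ := h
      exact ⟨fun _ => a, fun thru => ⟨c₀, hc₀, fun _ => ha⟩,
        Set.eq_univ_of_forall fun _ _ => ha⟩
    · exact ⟨fun _ => a₀, fun thru => ⟨c₀, hc₀, fun h' => (h h').elim⟩,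
        Set.eq_univ_of_forall fun _ h' => (h h').elim⟩

end Tasks

theorem IsCompleteSet.nonempty {M : Type w} [L.Structure M] {P : L.Relations 1} {A : Set M}
    (hA : IsCompleteSet P A) (hP : (predSet P M).Nonempty) : (A ∩ predSet P M).Nonempty := by
  obtain ⟨x, hx⟩ := hP
  obtain ⟨y, hy, -⟩ := hA 1 0 ⊤ Fin.elim0 (fun i => i.elim0)
    ⟨fun _ => x, fun _ => hx, by simp [Formula.Realize]⟩
  exact ⟨y 0, hy 0⟩

/-- The requirements of a level of the tree, given an enumeration of tasks. -/
noncomputable def levelReq {W Λ : Type w} [LinearOrder W] {M : Type w} [L.Structure M]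
    (P : L.Relations 1) (A : Set M) (a₀ : A) (e : ℕ → TaskCode L)
    (g : Λ → ℕ × Node W × (ℕ → ParamName W Λ × ℕ)) (k : W × Λ) (η : W → Bool)
    (val : ParamName W Λ → ℕ → A) (v : ℕ → A) : Set M :=
  taskReq P A ((g k.2).2.1 = node η k.1)
    -- Parameters that are not of lower level are replaced by `a₀`; this forces a requirement to
    -- depend only on values chosen earlier.
    (fun i => if ((g k.2).2.2 i).1.level < k.1 then
      val ((g k.2).2.2 i).1 ((g k.2).2.2 i).2 else a₀) v (e (g k.2).1)

/-- The set of realisations of an instance of `φ`. -/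
def instSet {M : Type w} [L.Structure M] {m : ℕ} (φ : L.Formula (Fin 1 ⊕ Fin m)) (A : Set M)
    (v : ℕ → A) : Set M :=
  {c | φ.Realize (Sum.elim ![c] fun i : Fin m => (v i : M))}

theorem definedOver_inst {M : Type w} [L.Structure M] {m : ℕ} (φ : L.Formula (Fin 1 ⊕ Fin m))
    {A : Set M} {v : Fin m → M} (hv : ∀ i, v i ∈ A) :
    DefinedOver L A {c | φ.Realize (Sum.elim ![c] v)} := by
  convert! DefinedOver.of_formula (A := A) (φ.relabel Sum.swap) hv using 3
  rw [Formula.realize_relabel]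
  refine iff_of_eq (congrArg _ ?_)
  funext i; cases i <;> rfl

/-- Finitely many requirements on the branches can be met inside the given model. -/
theorem exists_levelReq {W Λ : Type w} [LinearOrder W] {M : Type w} [L.Structure M]
    {P : L.Relations 1} {A : Set M} (hA : IsCompleteSet P A) (a₀ : A) (e : ℕ → TaskCode L)
    (g : Λ → ℕ × Node W × (ℕ → ParamName W Λ × ℕ)) {X₀ : Set M} (hX₀ : DefinedOver L A X₀)
    (hne : X₀.Nonempty) {m : ℕ} (φ : L.Formula (Fin 1 ⊕ Fin m))
    (hsplit : ∀ X, DefinedOver L A X → X.Nonempty → X ⊆ X₀ → ∃ b : Fin m → M, (∀ i, b i ∈ A) ∧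
      (∃ c ∈ X, φ.Realize (Sum.elim ![c] b)) ∧ ∃ c ∈ X, ¬ φ.Realize (Sum.elim ![c] b))
    (S : Finset (ParamName W Λ)) :
    ∃ val : ParamName W Λ → ℕ → A, ∀ η : W → Bool, ∃ c : M, ∀ k ∈ S,
      c ∈ branchReq (instSet φ A) (levelReq P A a₀ e g) η val k := by
  have : Inhabited (ℕ → A) := ⟨fun _ => a₀⟩
  have key := exists_branchReq (W := W) (Λ := Λ) {X : Set M | DefinedOver L A X}
    (fun X hX Y hY => DefinedOver.inter hX hY) DefinedOver.univ hX₀ hne (instSet φ A)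
    (fun v => definedOver_inst φ fun i => (v i).2)
    (fun v => (definedOver_inst φ fun i => (v i).2).compl) ?_ (levelReq P A a₀ e g) ?_ ?_ ?_ ?_ S
  · obtain ⟨val, hval⟩ := key
    refine ⟨val, fun η => ?_⟩
    obtain ⟨c, -, hc⟩ := hval η
    exact ⟨c, by simpa using hc⟩
  · intro X hX hXne hXX
    obtain ⟨b, hb, ⟨c, hc, hcb⟩, c', hc', hcb'⟩ := hsplit X hX hXne hXX
    refine ⟨fun i => if hi : i < m then ⟨b ⟨i, hi⟩, hb _⟩ else a₀, ⟨c, hc, ?_⟩, c', hc', ?_⟩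
    · simpa [instSet] using hcb
    · simpa [instSet] using hcb'
  · intro k η η' val v h
    simp only [levelReq, node_eq_of_agree h]
  · intro k η val val' v h
    simp only [levelReq]
    congr 1
    funext i
    split_ifs with hi
    · rw [h _ hi]
    · rfl
  · intro k η val v
    exact definedOver_taskReq _ _ _ _ _ _
  · intro k val
    refine ⟨(g k.2).2.1, fun X hX hXne => ?_⟩
    obtain ⟨v, hv, hv'⟩ := exists_taskReq P hA a₀
      (fun i => if ((g k.2).2.2 i).1.level < k.1 then
        val ((g k.2).2.2 i).1 ((g k.2).2.2 i).2 else a₀) (e (g k.2).1) hX hXne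
    refine ⟨v, fun η => ⟨fun _ => hv _, fun h => ?_⟩⟩
    simp only [levelReq, h]
    exact hv'

/-- A task code contains an `ω`-sequence of names, and `continuum ^ ℵ₀ = continuum`. So continuum
many slots per level suffice to list every task at every level. -/
theorem mk_tasks_le {W Λ : Type w} [LinearOrder W] (hW : #W ≤ continuum)
    (hΛ : #Λ ≤ continuum) (hnode : ∀ x : W, #(Set.Iio x → Bool) ≤ continuum) :
    #(ParamName W Λ) ≤ continuum ∧ #(ℕ × Node W × (ℕ → ParamName W Λ × ℕ)) ≤ continuum := by
  have h1 : #(Node W) ≤ continuum := by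
    rw [mk_sigma]
    refine (sum_le_mk_mul_iSup _).trans ?_
    refine (mul_le_mul' hW (ciSup_le' hnode)).trans ?_
    rw [continuum_mul_self]
  have h2 : #(ParamName W Λ) ≤ continuum := by
    rw [mk_sum, mk_prod]
    simp only [lift_id]
    refine (add_le_add h1 (mul_le_mul' hW hΛ)).trans ?_
    rw [continuum_mul_self, continuum_add_self]
  refine ⟨h2, ?_⟩
  have h3 : #(ParamName W Λ × ℕ) ≤ continuum := by
    rw [mk_prod]
    simp only [lift_uzero, mk_nat, lift_aleph0]
    refine (mul_le_mul' h2 le_rfl).trans ?_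
    rw [continuum_mul_aleph0]
  have h4 : #(ℕ → ParamName W Λ × ℕ) ≤ continuum := by
    rw [mk_arrow]
    simp only [lift_uzero, mk_nat, lift_aleph0]
    refine (power_le_power_right h3).trans ?_
    rw [continuum_power_aleph0]
  simp only [mk_prod, lift_id, lift_uzero, mk_nat, lift_aleph0]
  refine (mul_le_mul' le_rfl (mul_le_mul' h1 h4)).trans ?_
  simp

theorem realize_snoc_ultraMk {I : Type*} {U : Ultrafilter I} {M : I → Type*}
    [∀ i, L.Structure (M i)] [∀ i, Nonempty (M i)] {n : ℕ} (χ : L.BoundedFormula Empty (n + 1))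
    (x : Fin n → ∀ i, M i) (a : ∀ i, M i) :
    χ.Realize default (Fin.snoc (fun l => ultraMk U (x l)) (ultraMk U a)) ↔
      ∀ᶠ i in U, χ.Realize default (Fin.snoc (fun l => x l i) (a i)) := by
  have h := Ultraproduct.boundedFormula_realize_cast (u := U) χ (default : Empty → ∀ i, M i)
    (Fin.snoc x a)
  have h1 : (fun l => ultraMk U ((Fin.snoc x a : Fin (n + 1) → ∀ i, M i) l)) =
      Fin.snoc (fun l => ultraMk U (x l)) (ultraMk U a) := by
    funext l; refine Fin.lastCases ?_ (fun l => ?_) l <;> simp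
  have h2 : ∀ i, (fun l => (Fin.snoc x a : Fin (n + 1) → ∀ i, M i) l i) =
      Fin.snoc (fun l => x l i) (a i) := fun i => by
    funext l; refine Fin.lastCases ?_ (fun l => ?_) l <;> simp
  rw [← h1]
  simp only [← h2]
  refine Iff.trans ?_ (h.trans ?_)
  · exact iff_of_eq (congrArg (fun t => χ.Realize t _) (Subsingleton.elim _ _))
  · exact Filter.eventually_congr (Filter.Eventually.of_forall fun i =>
      iff_of_eq (congrArg (fun t => χ.Realize t _) (Subsingleton.elim _ _)))

/-- A set which is a family of values of sequences in an ultrapower, closed under witnesses for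
existential formulas of `A`, is elementarily equivalent to `A`. -/
theorem elementarilyEquivalent_of_henkin {I : Type w} {U : Ultrafilter I} {M : Type w}
    [L.Structure M] [Nonempty M] {A : Set M} [Nonempty A] {J : Type*} (s : J → I → A)
    (h : ∀ (n : ℕ) (χ : (predLang L).BoundedFormula Empty (n + 1)) (x : Fin n → J),
      ∃ j : J, ∀ᶠ i in U, (∃ a : A, χ.Realize default (Fin.snoc (fun l => s (x l) i) a)) →
        χ.Realize default (Fin.snoc (fun l => s (x l) i) (s j i))) :
    (Set.range fun j => ultraMk U (M := fun _ : I => M) fun i => (s j i : M) :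
      Set ((U : Filter I).Product fun _ => M)) ≅[predLang L] A := by
  set B : Set ((U : Filter I).Product fun _ => M) :=
    Set.range fun j => ultraMk U (M := fun _ : I => M) fun i => (s j i : M) with hB
  have hex : ∀ b : B, ∃ j, (ultraMk U (M := fun _ : I => M) fun i => (s j i : M)) = b := fun b =>
    b.2
  choose r hr using hex
  -- Representatives are chosen with values in `A`, so `B` embeds into the ultrapower of the
  -- structure `A`. The hypothesis is the Tarski–Vaught test for this embedding, and Łoś's theorem
  -- compares the ultrapower with `A`.
  let f : B → (U : Filter I).Product fun _ => A := fun b => ultraMk U (M := fun _ => A) (s (r b))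
  have hinj : Function.Injective f := by
    intro b b' hbb
    have := ultraMk_eq_iff.1 hbb
    apply Subtype.ext
    rw [← hr b, ← hr b', ultraMk_eq_iff]
    exact this.mono fun i hi => congrArg Subtype.val hi
  let F : B ↪[predLang L] (U : Filter I).Product fun _ => A :=
    { toFun := f
      inj' := hinj
      map_fun' := fun g _ => nomatch g
      map_rel' := fun {n} R x => by
        have h1 := relMap_ultraMk (L := predLang L) (U := U) (M := fun _ => A) R
          fun b => s (r (x b))
        have h2 := relMap_ultraMk (L := L) (U := U) (M := fun _ => M) R
          fun b i => (s (r (x b)) i : M)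
        refine h1.trans (Iff.trans ?_ (h2.symm.trans ?_))
        · rfl
        · simp only [hr]; rfl }
  have htv : ∀ (n : ℕ) (χ : (predLang L).BoundedFormula Empty (n + 1)) (x : Fin n → B)
      (a : (U : Filter I).Product fun _ => A),
      χ.Realize default (Fin.snoc (F ∘ x) a : _ → (U : Filter I).Product fun _ => A) →
        ∃ b : B, χ.Realize default
          (Fin.snoc (F ∘ x) (F b) : _ → (U : Filter I).Product fun _ => A) := by
    intro n χ x a ha
    obtain ⟨a, rfl⟩ := ultraMk_surjective a
    obtain ⟨j, hj⟩ := h n χ fun l => r (x l)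
    have ha' := (realize_snoc_ultraMk χ (fun l => s (r (x l))) a).1 ha
    let b : B := ⟨_, j, rfl⟩
    have hb : F b = ultraMk U (s j) :=
      ultraMk_eq_iff.2 ((ultraMk_eq_iff.1 (hr b)).mono fun i hi => Subtype.ext hi)
    refine ⟨b, ?_⟩
    rw [hb]
    exact (realize_snoc_ultraMk χ (fun l => s (r (x l))) (s j)).2
      ((ha'.and hj).mono fun i hi => hi.2 ⟨_, hi.1⟩)
  refine (F.toElementaryEmbedding htv).elementarilyEquivalent.trans ?_
  rw [elementarilyEquivalent_iff]
  intro φ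
  rw [Ultraproduct.sentence_realize, Filter.eventually_const]

/-- If every definable set splits, then there are many types over a set elementarily equivalent to
`A`. -/
theorem exists_large_family (hL : L.card ≤ ℵ₀) {T : L.Theory} {P : L.Relations 1}
    (M : Theory.ModelType.{u, v, w} T) (hP : (predSet P M).Nonempty) {A : Set M}
    (hA : IsCompleteSet P A)
    {X₀ : Set M} (hX₀ : DefinedOver L A X₀)
    (hne : X₀.Nonempty) {m : ℕ} (φ : L.Formula (Fin 1 ⊕ Fin m))
    (hsplit : ∀ X, DefinedOver L A X → X.Nonempty → X ⊆ X₀ → ∃ b : Fin m → M, (∀ i, b i ∈ A) ∧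
      (∃ c ∈ X, φ.Realize (Sum.elim ![c] b)) ∧ ∃ c ∈ X, ¬ φ.Realize (Sum.elim ![c] b)) :
    ∃ (N : Theory.ModelType.{u, v, w} T) (B : Set N) (H : Type w) (c : H → N),
      (B ≅[predLang L] A) ∧ #B ≤ continuum ∧ continuum < #H ∧
      (∀ η, WitnessedBy P B (B ∪ {c η})) ∧
      ∀ η η', η ≠ η' → ∃ b : Fin m → B, ¬ (φ.Realize (Sum.elim ![c η] fun i => (b i : N)) ↔
        φ.Realize (Sum.elim ![c η'] fun i => (b i : N))) := by
  classical
  obtain ⟨W, _, _, _, _, hW, hnode, hH⟩ := exists_tree_levels.{w}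
  let Λ : Type w := ULift.{w} (ℕ → Bool)
  have hΛ : #Λ = continuum := by simp [Λ]
  obtain ⟨hK, htask⟩ := mk_tasks_le hW hΛ.le hnode
  obtain ⟨e, he⟩ := exists_taskCode_enumeration hL
  obtain ⟨a₀⟩ : Nonempty A := (hA.nonempty hP).mono Set.inter_subset_left |>.to_subtype
  have : Nonempty A := ⟨a₀⟩
  let k₀ : ParamName W Λ := Sum.inr (Classical.arbitrary W, ⟨fun _ => true⟩)
  obtain ⟨g, hg⟩ : ∃ g : Λ → ℕ × Node W × (ℕ → ParamName W Λ × ℕ), Function.Surjective g := by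
    have : Nonempty (ℕ × Node W × (ℕ → ParamName W Λ × ℕ)) :=
      ⟨0, node (fun _ => true) (Classical.arbitrary W), fun _ => (k₀, 0)⟩
    obtain ⟨f⟩ : Nonempty ((ℕ × Node W × (ℕ → ParamName W Λ × ℕ)) ↪ Λ) :=
      (le_def _ _).1 (by rw [hΛ]; exact htask)
    exact ⟨Function.invFun f, Function.invFun_surjective f.injective⟩
  choose val c hc using exists_levelReq hA a₀ e g hX₀ hne φ hsplit
  -- The ultrafilter contains every cone, so each single requirement holds at almost all
  -- coordinates.
  let U : Ultrafilter (Finset (ParamName W Λ)) := Ultrafilter.of Filter.atTop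
  have hU : ∀ k, ∀ᶠ S in (U : Filter (Finset (ParamName W Λ))), k ∈ S := fun k =>
    Ultrafilter.of_le _ ((Filter.eventually_ge_atTop {k}).mono fun S hS =>
      Finset.singleton_subset_iff.1 hS)
  have hreq : ∀ k η, ∀ᶠ S in U, c S η ∈ branchReq (instSet φ A) (levelReq P A a₀ e g) η (val S) k :=
    fun k η => (hU k).mono fun S hS => hc S η k hS
  have hmod : ((U : Filter (Finset (ParamName W Λ))).Product fun _ => (M : Type w)) ⊨ T :=
    ultraproduct_models fun _ => M.is_model
  let s : ParamName W Λ × ℕ → Finset (ParamName W Λ) → A := fun q S => val S q.1 q.2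
  let d : ParamName W Λ × ℕ → (U : Filter (Finset (ParamName W Λ))).Product fun _ => (M : Type w) := fun q =>
    ultraMk U fun S => (s q S : M)
  let C : (W → Bool) → (U : Filter (Finset (ParamName W Λ))).Product fun _ => (M : Type w) := fun η =>
    ultraMk U fun S => c S η
  have hlevel : ∀ {n : ℕ} (x : Fin n → ParamName W Λ × ℕ), ∃ y : W, ∀ l, (x l).1.level < y := by
    intro n x
    obtain ⟨z, hz⟩ := (Set.finite_range fun l => (x l).1.level).bddAbove
    obtain ⟨y, hy⟩ := exists_gt z
    exact ⟨y, fun l => (hz ⟨l, rfl⟩).trans_lt hy⟩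
  -- every task is fulfilled
  have htaskreq : ∀ (cd : TaskCode L) {n : ℕ} (x : Fin n → ParamName W Λ × ℕ) (η : W → Bool),
      ∃ k, ∀ᶠ S in U, ∃ p : ℕ → A, (∀ i : Fin n, p i = s (x i) S) ∧
        c S η ∈ taskReq P A True p (fun i => s (k, i) S) cd := by
    intro cd n x η
    -- At a level above all the parameters the cut-off to `a₀` is inactive, and surjectivity of `g`
    -- provides a slot there for this task along this branch.
    obtain ⟨y, hy⟩ := hlevel x
    obtain ⟨t, rfl⟩ := he cd
    obtain ⟨l, hl⟩ := hg ⟨t, node η y, fun i => if hi : i < n then x ⟨i, hi⟩ else (k₀, 0)⟩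
    refine ⟨Sum.inr (y, l), (hreq (Sum.inr (y, l)) η).mono fun S hS => ?_⟩
    simp only [branchReq, levelReq, hl] at hS
    refine ⟨_, fun i => ?_, by simpa using hS⟩
    simp [hy, s]
  refine ⟨Theory.ModelType.of T ((U : Filter (Finset (ParamName W Λ))).Product fun _ => (M : Type w)), Set.range d,
    W → Bool, C, elementarilyEquivalent_of_henkin s ?_, ?_, hH, ?_, ?_⟩
  · intro n χ x
    obtain ⟨k, hk⟩ := htaskreq (Sum.inr ⟨n, χ⟩) x fun _ => true
    refine ⟨(k, 0), hk.mono ?_⟩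
    rintro S ⟨p, hp, hS⟩
    simpa [taskReq, hp] using hS
  · refine mk_range_le.trans ?_
    simp only [mk_prod, lift_uzero, mk_nat, lift_aleph0]
    refine (mul_le_mul' hK le_rfl).trans ?_
    rw [continuum_mul_aleph0]
  · rintro η m' n ψ b hb ⟨y, hyP, hy⟩
    let x : Fin n → ParamName W Λ × ℕ := fun i =>
      if h : b i ∈ Set.range d then h.choose else (k₀, 0)
    -- Parameters outside `B` equal `C η`; they are moved to the last variable so that the formula
    -- becomes a task.
    let ψ' : L.Formula (Fin m' ⊕ (Fin n ⊕ Fin 1)) := ψ.relabel (Sum.elim Sum.inl fun i =>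
      if b i ∈ Set.range d then Sum.inr (Sum.inl i) else Sum.inr (Sum.inr 0))
    have hψ' : ∀ z, ψ'.Realize (Sum.elim z (Sum.elim (fun i => d (x i)) ![C η])) ↔
        ψ.Realize (Sum.elim z b) := by
      intro z
      rw [Formula.realize_relabel]
      refine iff_of_eq (congrArg _ ?_)
      funext i
      rcases i with i | i
      · rfl
      · by_cases h : b i ∈ Set.range d
        · simp only [Function.comp_apply, Sum.elim_inr, h, if_true, Sum.elim_inl, x, dif_pos]
          exact h.choose_spec
        · have hbi : b i = C η := (hb i).resolve_left h
          simp only [Function.comp_apply, Sum.elim_inr, h, if_false]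
          exact hbi.symm
    have hlos : ∀ z : Fin m' → Finset (ParamName W Λ) → M,
        ψ.Realize (Sum.elim (fun i => ultraMk U (z i)) b) ↔ ∀ᶠ S in U,
          ψ'.Realize (Sum.elim (fun i => z i S) (Sum.elim (fun i => (s (x i) S : M)) ![c S η])) := by
      intro z
      have h2 : (Sum.elim (fun i => ultraMk U (z i)) (Sum.elim (fun i => d (x i)) ![C η])) =
          fun q => ultraMk U ((Sum.elim z (Sum.elim (fun i S => (s (x i) S : M))
            ![fun S => c S η]) : Fin m' ⊕ (Fin n ⊕ Fin 1) → Finset (ParamName W Λ) → M) q) := by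
        funext i
        rcases i with i | i | i
        · rfl
        · rfl
        · fin_cases i; rfl
      rw [← hψ', h2, realize_ultraMk]
      refine Filter.eventually_congr (Filter.Eventually.of_forall fun S =>
        iff_of_eq (congrArg _ ?_))
      funext i
      rcases i with i | i | i
      · rfl
      · rfl
      · fin_cases i; rfl
    choose z hz using fun i => ultraMk_surjective (y i)
    obtain rfl : (fun i => ultraMk U (z i)) = y := funext hz
    have hzP : ∀ᶠ S in U, ∀ i, z i S ∈ predSet P M :=
      Filter.eventually_all.2 fun i => (ultraMk_mem_predSet P (z i)).1 (hyP i)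
    obtain ⟨k, hk⟩ := htaskreq (Sum.inl ⟨m', n, ψ'⟩) x η
    have hkey : ∀ᶠ S in U, (∀ i : Fin m', (s (k, i) S : M) ∈ predSet P M) ∧
        ψ'.Realize (Sum.elim (fun i : Fin m' => (s (k, i) S : M))
          (Sum.elim (fun i => (s (x i) S : M)) ![c S η])) := by
      filter_upwards [hk, hzP, (hlos z).1 hy] with S hS hSP hSψ
      obtain ⟨p, hp, hS⟩ := hS
      simp only [taskReq, hp] at hS
      exact hS trivial ⟨_, hSP, hSψ⟩
    refine ⟨fun i => d (k, i), fun i => ⟨⟨_, rfl⟩, ?_⟩, ?_⟩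
    · exact (ultraMk_mem_predSet P _).2 (hkey.mono fun S hS => hS.1 i)
    · exact (hlos fun (i : Fin m') S => (s (k, i) S : M)).2 (hkey.mono fun S hS => hS.2)
  · intro η η' hne'
    -- At the least level where the branches differ, both pass through the same node, and its
    -- parameters separate them.
    obtain ⟨y, hy, hmin⟩ : ∃ y, η y ≠ η' y ∧ ∀ z < y, η z = η' z := by
      have hex : ∃ y, η y ≠ η' y := by
        by_contra! h
        exact hne' (funext h)
      have wf := (wellFounded_lt : WellFounded ((· < ·) : W → W → Prop))
      refine ⟨wf.min {y | η y ≠ η' y} hex, wf.min_mem {y | η y ≠ η' y} hex, fun z hz => ?_⟩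
      by_contra h
      exact wf.not_lt_min {y | η y ≠ η' y} h hz
    have hn := node_eq_of_agree hmin
    let k : ParamName W Λ := Sum.inl (node η y)
    refine ⟨fun i => ⟨d (k, i), ⟨_, rfl⟩⟩, fun hiff => ?_⟩
    have h1 : ∀ η₀, node η₀ y = node η y → (φ.Realize (Sum.elim ![C η₀] fun i : Fin m =>
        d (k, i)) ↔ η₀ y = true) := by
      intro η₀ hη₀
      have h2 : (Sum.elim ![C η₀] fun i : Fin m => d (k, i)) =
          fun b => ultraMk U ((Sum.elim ![fun S => c S η₀] fun (i : Fin m) S => (s (k, i) S : M) :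
            Fin 1 ⊕ Fin m → Finset (ParamName W Λ) → M) b) := by
        funext i
        rcases i with i | i
        · fin_cases i; rfl
        · rfl
      rw [h2, realize_ultraMk]
      refine Iff.trans ?_ (Filter.eventually_const (f := (U : Filter (Finset (ParamName W Λ)))))
      refine Filter.eventually_congr ((hreq k η₀).mono fun S hS => ?_)
      refine Iff.trans (iff_of_eq (congrArg _ ?_)) (hS hη₀.symm)
      funext i
      rcases i with i | i
      · fin_cases i; rfl
      · rfl
    replace hiff := (h1 η rfl).symm.trans (hiff.trans (h1 η' hn.symm))
    exact hy (Bool.eq_iff_iff.2 hiff)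

/-! ### Isolation over stable sets -/

/-- Over a complete stable set, every nonempty definable set contains a nonempty definable set
that decides all instances of a given formula. -/
theorem exists_deciding (hL : L.card ≤ ℵ₀) {T : L.Theory} {P : L.Relations 1}
    (M : Theory.ModelType.{u, v, w} T) (hP : (predSet P M).Nonempty) {A : Set M}
    (hA : IsCompleteSet P A) (hst : IsStableSet T P A) {X₀ : Set M} (hX₀ : DefinedOver L A X₀)
    (hne : X₀.Nonempty) {m : ℕ} (φ : L.Formula (Fin 1 ⊕ Fin m)) :
    ∃ X, DefinedOver L A X ∧ X.Nonempty ∧ X ⊆ X₀ ∧ ∀ b : Fin m → M, (∀ i, b i ∈ A) →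
      ∀ c ∈ X, ∀ c' ∈ X, φ.Realize (Sum.elim ![c] b) → φ.Realize (Sum.elim ![c'] b) := by
  by_contra! hcon
  obtain ⟨N, B, H, c, hBA, hB, hH, hwit, hdist⟩ := exists_large_family hL M hP hA hX₀ hne φ
    fun X hX hXne hXX => by
      obtain ⟨b, hb, c, hc, c', hc', h, h'⟩ := hcon X hX hXne hXX
      exact ⟨b, hb, ⟨c, hc, h⟩, c', hc', h'⟩
  have hbound := hst N B hBA
  -- This is where countability of the vocabulary enters the stability bound: the exponent is `ℵ₀`.
  have hsmall : lift.{max u v} #B ^ lift.{w} (max ℵ₀ L.card) ≤ continuum := by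
    rw [max_eq_left hL, lift_aleph0]
    refine (power_le_power_right ((lift_le.2 hB).trans (lift_continuum).le)).trans ?_
    rw [continuum_power_aleph0]
  let F : H → starTypes P B := fun η => ⟨⟨1, typeOver B ![c η]⟩, N, inferInstance,
    ElementaryEmbedding.refl L N, ![c η], by
      have hr : Set.range ![c η] = {c η} := by simp
      have hw := hwit η
      have hi : (ElementaryEmbedding.refl L N) '' B = B := Set.image_id B
      rw [hr, hi]
      refine ⟨?_, hw.isCompleteSet Set.subset_union_left, rfl⟩
      refine Set.Subset.antisymm (fun x hx => ⟨hx.1, hw.inter_subset ⟨hx.2, hx.1⟩⟩)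
        (Set.inter_subset_inter_right _ Set.subset_union_left)⟩
  have hF : Function.Injective F := by
    intro η η' h
    by_contra hne
    obtain ⟨b, hb⟩ := hdist η η' hne
    have h1 : typeOver (L := L) B ![c η] = typeOver B ![c η'] := by
      have h2 := congrArg Subtype.val h
      simpa [F] using h2
    have h3 : ∀ η, inst B φ b ∈ typeOver B ![c η] ↔
        φ.Realize (Sum.elim ![c η] fun i => (b i : N)) := fun η => by
      change (inst B φ b).Realize _ ↔ _
      rw [inst, Formula.realize_relabel]
      refine iff_of_eq (congrArg _ ?_)
      funext i; rcases i with i | i <;> rfl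
    have h4 := h3 η
    rw [h1, h3 η'] at h4
    exact hb h4.symm
  have h1 := lift_mk_le_lift_mk_of_injective hF
  have h2 : lift.{w} #(starTypes P B) ≤ continuum := by
    rw [← lift_continuum.{w, max u v w}]
    exact lift_le.2 (hbound.trans hsmall)
  have h3 : continuum < lift.{max u v w} #H := by
    rw [← lift_continuum.{max u v w, w}]
    exact lift_lt.2 hH
  exact absurd (h1.trans h2) (not_le.2 h3)

/-! ### Countable saturation and locally isolated elements -/

section Saturation

variable {M : Type w} [L.Structure M]

/-- Decreasing sequences of nonempty definable sets have nonempty intersection. -/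
def CountablySaturated (L : FirstOrder.Language.{u, v}) (M : Type w) [L.Structure M] : Prop :=
  ∀ X : ℕ → Set M, (∀ n, DefinedOver L Set.univ (X n)) → (∀ n, X (n + 1) ⊆ X n) →
    (∀ n, (X n).Nonempty) → ∃ c, ∀ n, c ∈ X n

theorem countablySaturated_ultrapower (M : Type w) [L.Structure M] [Nonempty M] :
    CountablySaturated L (((Filter.hyperfilter ℕ : Ultrafilter ℕ) : Filter ℕ).Product
      fun _ => M) := by
  classical
  intro X hX hanti hne
  have hanti : Antitone X := antitone_nat_of_succ_le hanti
  choose θ hθ using hX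
  let U : Ultrafilter ℕ := Filter.hyperfilter ℕ
  choose r hr using fun a : (U : Filter ℕ).Product fun _ => M => ultraMk_surjective a
  have key : ∀ n (c : ℕ → M), ultraMk U c ∈ X n ↔
      ∀ᶠ i in (U : Filter ℕ), (θ n).Realize (Sum.elim (fun a => r a.1 i) ![c i]) := by
    intro n c
    have h1 := realize_ultraMk (U := U) (θ n) (Sum.elim (fun a => r a.1) ![c])
    have h2 : (fun b => ultraMk U ((Sum.elim (fun a : (Set.univ : Set ((U : Filter ℕ).Product
        fun _ => M)) => r a.1) ![c] : _ → ℕ → M) b)) =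
        Sum.elim (fun a : (Set.univ : Set ((U : Filter ℕ).Product fun _ => M)) => a.1)
          ![ultraMk U c] := by
      funext i
      rcases i with i | i
      · exact hr _
      · fin_cases i; rfl
    rw [h2] at h1
    refine (hθ n _).trans (h1.trans (Filter.eventually_congr (Filter.Eventually.of_forall fun i =>
      iff_of_eq (congrArg _ ?_))))
    funext q
    rcases q with q | q
    · rfl
    · fin_cases q; rfl
  let good : ℕ → ℕ → Prop := fun i n =>
    ∃ c : M, ∀ k ≤ n, (θ k).Realize (Sum.elim (fun a => r a.1 i) ![c])
  have hgood : ∀ n, ∀ᶠ i in (U : Filter ℕ), good i n := by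
    intro n
    obtain ⟨c, hc⟩ := hne n
    obtain ⟨c, rfl⟩ := ultraMk_surjective c
    have : ∀ᶠ i in (U : Filter ℕ), ∀ k ∈ Finset.Iic n,
        (θ k).Realize (Sum.elim (fun a => r a.1 i) ![c i]) :=
      (Filter.eventually_all_finset _).2 fun k hk => (key k c).1 (hanti (Finset.mem_Iic.1 hk) hc)
    exact this.mono fun i hi => ⟨c i, fun k hk => hi k (Finset.mem_Iic.2 hk)⟩
  -- Coordinate `i` solves the conditions up to the greatest index at most `i` for which they are
  -- jointly solvable there. As the ultrafilter is nonprincipal, every fixed index is reached almost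
  -- everywhere.
  have hch : ∀ i, ∃ c : M, ∀ n ≤ i, good i n →
      (θ n).Realize (Sum.elim (fun a => r a.1 i) ![c]) := by
    intro i
    by_cases h : ∃ n ≤ i, good i n
    · obtain ⟨n, hn, hgn⟩ := h
      obtain ⟨c, hc⟩ := Nat.findGreatest_spec hn hgn
      exact ⟨c, fun k hk hgk => hc k (Nat.le_findGreatest hk hgk)⟩
    · exact ⟨Classical.arbitrary M, fun n hn hgn => (h ⟨n, hn, hgn⟩).elim⟩
  choose c hc using hch
  refine ⟨ultraMk U c, fun n => (key n c).2 ?_⟩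
  have hlarge : ∀ᶠ i in (U : Filter ℕ), n ≤ i :=
    Nat.hyperfilter_le_atTop (Filter.eventually_ge_atTop n)
  exact (hlarge.and (hgood n)).mono fun i hi => hc i n hi.1 hi.2

/-- Semantic form of local isolation of `tp(c/B)`. -/
def LocallyIsolatedAt (L : FirstOrder.Language.{u, v}) {M : Type w} [L.Structure M] (B : Set M)
    (c : M) : Prop :=
  ∀ (m : ℕ) (φ : L.Formula (Fin 1 ⊕ Fin m)), ∃ X, DefinedOver L B X ∧ c ∈ X ∧
    ∀ b : Fin m → M, (∀ i, b i ∈ B) → ∀ c ∈ X, ∀ c' ∈ X,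
      φ.Realize (Sum.elim ![c] b) → φ.Realize (Sum.elim ![c'] b)

/-- A locally isolated type over a complete set keeps the set complete, without enlarging `P`. -/
theorem LocallyIsolatedAt.witnessedBy {P : L.Relations 1} {A : Set M} (hA : IsCompleteSet P A)
    {c : M} (hc : LocallyIsolatedAt L A c) : WitnessedBy P A (A ∪ {c}) := by
  classical
  rintro m n ψ b hb ⟨y, hyP, hy⟩
  -- An empty tuple needs no witness; otherwise `P` is nonempty, and completeness yields the default
  -- element `a₀` of `A`.
  rcases m.eq_zero_or_pos with rfl | hm
  · exact ⟨y, fun i => i.elim0, hy⟩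
  obtain ⟨a₀, ha₀, -⟩ := hA.nonempty ⟨_, hyP ⟨0, hm⟩⟩
  let d : Fin n → M := fun i => if b i ∈ A then b i else a₀
  have hd : ∀ i, d i ∈ A := fun i => by
    by_cases h : b i ∈ A <;> simp [d, h, ha₀]
  let ψ' : L.Formula (Fin m ⊕ (Fin n ⊕ Fin 1)) := ψ.relabel (Sum.elim Sum.inl fun i =>
    if b i ∈ A then Sum.inr (Sum.inl i) else Sum.inr (Sum.inr 0))
  have hψ' : ∀ z, ψ'.Realize (Sum.elim z (Sum.elim d ![c])) ↔ ψ.Realize (Sum.elim z b) := by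
    intro z
    rw [Formula.realize_relabel]
    refine iff_of_eq (congrArg _ ?_)
    funext i
    rcases i with i | i
    · rfl
    · by_cases h : b i ∈ A
      · simp [h, d]
      · have hbi : b i = c := (hb i).resolve_left h
        simp [hbi ▸ h, hbi]
  -- The candidate witnesses now count as parameters. A witness in `A` found for some `c'` in the
  -- deciding set then also works for `c`.
  let φ : L.Formula (Fin 1 ⊕ Fin (m + n)) := ψ'.relabel
    (Sum.elim (fun i => Sum.inr (Fin.castAdd n i))
      (Sum.elim (fun i => Sum.inr (Fin.natAdd m i)) Sum.inl))
  have hφ : ∀ z c, φ.Realize (Sum.elim ![c] (Fin.append z d)) ↔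
      ψ'.Realize (Sum.elim z (Sum.elim d ![c])) := by
    intro z c
    rw [Formula.realize_relabel]
    refine iff_of_eq (congrArg _ ?_)
    funext i
    rcases i with i | i | i <;> simp
  obtain ⟨X, hX, hcX, hdec⟩ := hc _ φ
  obtain ⟨x, hx, c', hc', hxc'⟩ := exists_witness hA hX ψ' hd hyP hcX ((hψ' y).2 hy)
  refine ⟨x, hx, (hψ' x).1 ((hφ x c).1 (hdec _ ?_ c' hc' c hcX ((hφ x c').2 hxc')))⟩
  intro i
  refine Fin.addCases (fun i => ?_) (fun i => ?_) i
  · simpa using (hx i).1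
  · simpa using hd i

end Saturation

/-- Over a complete stable set in a countably saturated model, every nonempty definable set
contains an element with locally isolated type. -/
theorem exists_locallyIsolatedAt (hL : L.card ≤ ℵ₀) {T : L.Theory} {P : L.Relations 1}
    (M : Theory.ModelType.{u, v, w} T) (hsat : CountablySaturated L M)
    (hP : (predSet P M).Nonempty) {A : Set M}
    (hA : IsCompleteSet P A) (hst : IsStableSet T P A) {X₀ : Set M} (hX₀ : DefinedOver L A X₀)
    (hne : X₀.Nonempty) : ∃ c ∈ X₀, LocallyIsolatedAt L A c := by
  have hcount : Countable (Σ m, L.Formula (Fin 1 ⊕ Fin m)) := by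
    have := fun m => countable_formula hL (Fin 1 ⊕ Fin m) 0
    infer_instance
  have : Nonempty (Σ m, L.Formula (Fin 1 ⊕ Fin m)) := ⟨⟨0, ⊤⟩⟩
  obtain ⟨e, he⟩ := exists_surjective_nat (Σ m, L.Formula (Fin 1 ⊕ Fin m))
  let D := {X : Set M // DefinedOver L A X ∧ X.Nonempty}
  have hstep : ∀ (X : D) (φ : Σ m, L.Formula (Fin 1 ⊕ Fin m)), ∃ Y : D, Y.1 ⊆ X.1 ∧
      ∀ b : Fin φ.1 → M, (∀ i, b i ∈ A) → ∀ c ∈ Y.1, ∀ c' ∈ Y.1,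
        φ.2.Realize (Sum.elim ![c] b) → φ.2.Realize (Sum.elim ![c'] b) := by
    rintro ⟨X, hX, hXne⟩ ⟨m, φ⟩
    obtain ⟨Y, hY, hYne, hYX, hdec⟩ := exists_deciding hL M hP hA hst hX hXne φ
    exact ⟨⟨Y, hY, hYne⟩, hYX, hdec⟩
  choose G hG hG' using hstep
  -- Stage `n + 1` decides the formula `e n`; saturation gives a point of all stages, which is
  -- isolated formula by formula.
  let X : ℕ → D := fun n => Nat.rec ⟨X₀, hX₀, hne⟩ (fun k Y => G Y (e k)) n
  obtain ⟨c, hc⟩ := hsat (fun n => (X n).1) (fun n => (X n).2.1.mono (Set.subset_univ _))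
    (fun n => hG _ _) fun n => (X n).2.2
  refine ⟨c, hc 0, fun m φ => ?_⟩
  obtain ⟨n, hn⟩ := he ⟨m, φ⟩
  refine ⟨(X (n + 1)).1, (X (n + 1)).2.1, hc (n + 1), ?_⟩
  have := hG' (X n) (e n)
  rw [hn] at this
  simpa only [X, hn] using this

/-! ### Construction of a model by locally isolated types -/

section Bookkeeping

/-- The index set of the construction over a set of size `#A`. -/
abbrev ConstrIndex (A : Type w) : Type w := (#A + ℵ₀).ord.ToType

theorem mk_constrIndex (A : Type w) : #(ConstrIndex A) = #A + ℵ₀ := mk_ord_toType _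

instance (A : Type w) : NoMaxOrder (ConstrIndex A) := Cardinal.noMaxOrder (self_le_add_left _ _)

instance (A : Type w) : Nonempty (ConstrIndex A) := by
  rw [← mk_ne_zero_iff, mk_constrIndex]
  exact (aleph0_pos.trans_le (self_le_add_left _ _)).ne'

theorem lift_mk_formula_le (hL : L.card ≤ ℵ₀) (A : Type w) :
    lift.{w} #(L.Formula ((A ⊕ ConstrIndex A) ⊕ Fin 1)) ≤
      lift.{max u v w} #(ConstrIndex A) := by
  have h0 : ℵ₀ ≤ #(ConstrIndex A) := by rw [mk_constrIndex]; exact self_le_add_left _ _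
  have h1 : #(L.Formula ((A ⊕ ConstrIndex A) ⊕ Fin 1)) ≤
      #(Σ n, L.BoundedFormula ((A ⊕ ConstrIndex A) ⊕ Fin 1) n) :=
    mk_le_of_injective
      (sigma_mk_injective (β := fun n => L.BoundedFormula ((A ⊕ ConstrIndex A) ⊕ Fin 1) n) (i := 0))
  have h2 : #((A ⊕ ConstrIndex A) ⊕ Fin 1) ≤ #(ConstrIndex A) := by
    rw [mk_sum, mk_sum]
    simp only [lift_id, lift_uzero, mk_fin]
    have hA : #A ≤ #(ConstrIndex A) := by rw [mk_constrIndex]; exact self_le_add_right _ _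
    refine (add_le_add (add_le_add hA le_rfl) (?_ : _ ≤ #(ConstrIndex A))).trans ?_
    · simpa using one_le_aleph0.trans h0
    · rw [add_eq_self h0, add_eq_self h0]
  have h3 : #(L.Formula ((A ⊕ ConstrIndex A) ⊕ Fin 1)) ≤ lift.{max u v} #(ConstrIndex A) := by
    refine (h1.trans BoundedFormula.card_le).trans (max_le (by simp) ?_)
    refine (add_le_add (lift_le.2 h2) ((lift_le.2 hL).trans ?_)).trans
      (add_eq_self (by simp)).le
    simp
  have h4 := lift_le.{w}.2 h3
  simpa using h4

/-- Every formula is considered at unboundedly many stages of the construction. -/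
theorem exists_bookkeeping (hL : L.card ≤ ℵ₀) (A : Type w) :
    ∃ g : ConstrIndex A → L.Formula ((A ⊕ ConstrIndex A) ⊕ Fin 1),
      ∀ φ j₀, ∃ i, j₀ < i ∧ g i = φ := by
  obtain ⟨f⟩ := lift_mk_le'.1 (lift_mk_formula_le hL A)
  have h0 : ℵ₀ ≤ #(ConstrIndex A) := by rw [mk_constrIndex]; exact self_le_add_left _ _
  obtain ⟨p⟩ : Nonempty (ConstrIndex A × ConstrIndex A ≃ ConstrIndex A) :=
    Cardinal.eq.1 (by simp only [mk_prod, lift_id, mul_eq_self h0])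
  have : Nonempty (L.Formula ((A ⊕ ConstrIndex A) ⊕ Fin 1)) := ⟨⊤⟩
  refine ⟨fun i => Function.invFun f (p.symm i).2, fun φ j₀ => ?_⟩
  by_contra! hcon
  -- All indices `p (x, f φ)` carry `φ`. If they were bounded, as many elements as the whole index
  -- set would fit into a proper initial segment of an initial ordinal.
  have hle : ∀ x, p (x, f φ) ≤ j₀ := fun x => by
    by_contra! h
    exact hcon _ h (by simp [Function.leftInverse_invFun f.injective φ])
  obtain ⟨j₁, hj₁⟩ := exists_gt j₀
  have hinj : Function.Injective fun x => (⟨p (x, f φ), (hle x).trans_lt hj₁⟩ : Set.Iio j₁) := by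
    intro x y hxy
    have := congrArg Subtype.val hxy
    simpa using this
  exact absurd (mk_le_of_injective hinj) (not_le.2 (mk_Iio_lt j₁ (by simp)))

end Bookkeeping

/-- A finite tuple of elements enumerated by `d` is contained in a proper initial segment. -/
theorem exists_index_bound {M J : Type*} [LinearOrder J] {A : Set M} {d : J → M} {S : Set J}
    {n : ℕ} {b : Fin n → M} (hb : ∀ l, b l ∈ A ∪ d '' S) :
    (∀ l, b l ∈ A) ∨ ∃ j ∈ S, ∀ l, b l ∈ A ∪ d '' Set.Iic j := by
  classical
  by_cases h : ∀ l, b l ∈ A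
  · exact Or.inl h
  right
  push Not at h
  have hex : ∀ l, ∃ j, b l ∉ A → j ∈ S ∧ d j = b l := by
    intro l
    by_cases hl : b l ∈ A
    · obtain ⟨l', hl'⟩ := h
      obtain ⟨j, -, -⟩ := (hb l').resolve_left hl'
      exact ⟨j, fun h => (h hl).elim⟩
    · obtain ⟨j, hj⟩ := (hb l).resolve_left hl
      exact ⟨j, fun _ => hj⟩
  choose r hr using hex
  obtain ⟨l₀, hl₀⟩ := h
  obtain ⟨l₁, hl₁, hmax⟩ := Finset.exists_max_image
    (Finset.univ.filter fun l => b l ∉ A) r ⟨l₀, by simpa using hl₀⟩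
  simp only [Finset.mem_filter, Finset.mem_univ, true_and] at hl₁ hmax
  refine ⟨r l₁, (hr l₁ hl₁).1, fun l => ?_⟩
  by_cases hl : b l ∈ A
  · exact Or.inl hl
  · exact Or.inr ⟨r l, hmax l hl, (hr l hl).2⟩

/-- Every stage is witnessed by `A`, hence complete with the same `P`-part, hence stable, so a
locally isolated solution of the scheduled formula can be added. Limits are harmless because finite
tuples live in an earlier stage. -/
theorem exists_construction (hL : L.card ≤ ℵ₀) {T : L.Theory} {P : L.Relations 1}
    (M : Theory.ModelType.{u, v, w} T) (hsat : CountablySaturated L M)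
    (hP : (predSet P M).Nonempty) {A : Set M} (hA : IsCompleteSet P A)
    (hst : ∀ B, A ⊆ B → WitnessedBy P A B → IsStableSet T P B) :
    ∃ d : ConstrIndex A → M, (∀ i, LocallyIsolatedAt L (A ∪ d '' Set.Iio i) (d i)) ∧
      WitnessedBy P A (A ∪ Set.range d) ∧
      ∀ X, DefinedOver L (A ∪ Set.range d) X → X.Nonempty → (X ∩ (A ∪ Set.range d)).Nonempty := by
  classical
  obtain ⟨g, hg⟩ := exists_bookkeeping hL A
  obtain ⟨a₀, ha₀, -⟩ := hA.nonempty hP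
  -- Names of elements not yet built are read as `a₀`, so that the parameters available at stage `i`
  -- are exactly `A` and the earlier `d j`.
  let interp : (i : ConstrIndex A) → (∀ j < i, M) → A ⊕ ConstrIndex A → M := fun i prev =>
    Sum.elim (fun a => a) fun j => if h : j < i then prev j h else a₀
  let sol : (i : ConstrIndex A) → (∀ j < i, M) → Set M := fun i prev =>
    {c | (g i).Realize (Sum.elim (interp i prev) ![c])}
  let G : (i : ConstrIndex A) → (∀ j < i, M) → M := fun i prev =>
    if h : ∃ c, LocallyIsolatedAt L (Set.range (interp i prev)) c ∧
      ((sol i prev).Nonempty → c ∈ sol i prev) then h.choose else a₀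
  let d : ConstrIndex A → M := wellFounded_lt.fix G
  have hd : ∀ i, d i = G i fun j _ => d j := fun i => wellFounded_lt.fix_eq G i
  have hrange : ∀ i, Set.range (interp i fun j _ => d j) = A ∪ d '' Set.Iio i := by
    intro i
    ext x
    constructor
    · rintro ⟨q | j, rfl⟩
      · exact Or.inl q.2
      · by_cases h : j < i
        · exact Or.inr ⟨j, h, by simp [interp, h]⟩
        · exact Or.inl (by simpa [interp, h] using ha₀)
    · rintro (h | ⟨j, hj, rfl⟩)
      · exact ⟨Sum.inl ⟨x, h⟩, rfl⟩
      · exact ⟨Sum.inr j, by simp [interp, Set.mem_Iio.1 hj]⟩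
  have hstep : ∀ i, WitnessedBy P A (A ∪ d '' Set.Iio i) →
      LocallyIsolatedAt L (A ∪ d '' Set.Iio i) (d i) ∧
        ((sol i fun j _ => d j).Nonempty → d i ∈ sol i fun j _ => d j) := by
    intro i hi
    have hc := hi.isCompleteSet Set.subset_union_left
    have hs := hst _ Set.subset_union_left hi
    have hX : DefinedOver L (A ∪ d '' Set.Iio i) (sol i fun j _ => d j) :=
      DefinedOver.of_formula _ fun q => (hrange i) ▸ ⟨q, rfl⟩
    have hex : ∃ c, LocallyIsolatedAt L (Set.range (interp i fun j _ => d j)) c ∧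
        ((sol i fun j _ => d j).Nonempty → c ∈ sol i fun j _ => d j) := by
      rw [hrange i]
      by_cases hne : (sol i fun j _ => d j).Nonempty
      · obtain ⟨c, hcX, hc⟩ := exists_locallyIsolatedAt hL M hsat hP hc hs hX hne
        exact ⟨c, hc, fun _ => hcX⟩
      · obtain ⟨c, -, hc⟩ := exists_locallyIsolatedAt hL M hsat hP hc hs
          DefinedOver.univ ⟨a₀, trivial⟩
        exact ⟨c, hc, fun h => (hne h).elim⟩
    have hdi : d i = hex.choose := by
      rw [hd i]
      exact dif_pos hex
    rw [hdi, ← hrange i]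
    exact hex.choose_spec
  have hIic : ∀ i, WitnessedBy P A (A ∪ d '' Set.Iio i) →
      WitnessedBy P A (A ∪ d '' Set.Iic i) := by
    intro i hi
    have hc := hi.isCompleteSet Set.subset_union_left
    have h1 := LocallyIsolatedAt.witnessedBy hc (hstep i hi).1
    have h2 : A ∪ d '' Set.Iic i = A ∪ d '' Set.Iio i ∪ {d i} := by
      rw [← Set.Iio_insert, Set.image_insert_eq, Set.union_insert, Set.union_singleton]
    rw [h2]
    exact h1.union_subset hi.inter_subset
  have hloc : ∀ S : Set (ConstrIndex A), (∀ j ∈ S, WitnessedBy P A (A ∪ d '' Set.Iic j)) →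
      WitnessedBy P A (A ∪ d '' S) := by
    intro S hS m n ψ b hb hx
    rcases exists_index_bound hb with h | ⟨j, hj, h⟩
    · exact hA m n ψ b h hx
    · exact hS j hj m n ψ b h hx
  have hwit : ∀ i, WitnessedBy P A (A ∪ d '' Set.Iio i) := by
    intro i
    induction i using WellFoundedLT.induction with
    | ind i ih => exact hloc _ fun j hj => hIic j (ih j hj)
  refine ⟨d, fun i => (hstep i (hwit i)).1, ?_, ?_⟩
  · rw [← Set.image_univ]
    exact hloc _ fun j _ => hIic j (hwit j)
  · rintro X ⟨θ, hθ⟩ hne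
    obtain ⟨n, a, θ', -, hθ'⟩ := exists_finite_support.{u, v, w} θ
    have hq : ∀ l, ∃ q : A ⊕ ConstrIndex A, Sum.elim (fun a : A => (a : M)) d q = a l := by
      intro l
      rcases (a l).2 with h | ⟨j, hj⟩
      · exact ⟨Sum.inl ⟨_, h⟩, rfl⟩
      · exact ⟨Sum.inr j, hj⟩
    choose q hq using hq
    -- The formula is picked up at a stage after all its parameters have been built, where the names
    -- have their intended values.
    obtain ⟨j₀, hj₀⟩ : ∃ j₀, ∀ l j, q l = Sum.inr j → j ≤ j₀ := by
      obtain ⟨j₀, hj₀⟩ := (Set.finite_range fun l => Sum.elim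
        (fun _ => Classical.arbitrary (ConstrIndex A)) id (q l)).bddAbove
      exact ⟨j₀, fun l j hj => hj₀ ⟨l, by simp [hj]⟩⟩
    obtain ⟨i, hi, hgi⟩ := hg (θ'.relabel (Sum.map q id)) j₀
    have hsol : (sol i fun j _ => d j) = X := by
      ext c
      rw [hθ, ← hθ' M, Set.mem_ofPred_eq, hgi, Formula.realize_relabel]
      refine iff_of_eq (congrArg _ ?_)
      funext l
      rcases l with l | l
      · simp only [Function.comp_apply, Sum.map_inl, Sum.elim_inl, ← hq l]
        rcases hql : q l with x | j
        · rfl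
        · simp [interp, (hj₀ l j hql).trans_lt hi]
      · rfl
    rw [← hsol] at hne ⊢
    exact ⟨d i, (hstep i (hwit i)).2 hne, Or.inr ⟨i, rfl⟩⟩

/-! ### Isolation of types and elementary substructures -/

section Isolated

theorem realize_inst {M N : Type w} [L.Structure N] {B : Set M} {n m : ℕ}
    (φ : L.Formula (Fin n ⊕ Fin m)) (b : Fin m → B) (f : B → N) (c : Fin n → N) :
    (inst B φ b).Realize (Sum.elim f c) ↔ φ.Realize (Sum.elim c fun i => f (b i)) := by
  rw [inst, Formula.realize_relabel]
  refine iff_of_eq (congrArg _ ?_)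
  funext i; rcases i with i | i <;> rfl

variable {M : Type w} [L.Structure M]

/-- An implication between formulas passes to elementary extensions. -/
theorem mem_typeVia_of_forall {B : Set M} {θ ψ : L.Formula (B ⊕ Fin 1)}
    (h : ∀ c : M, θ.Realize (Sum.elim (fun b : B => (b : M)) ![c]) →
      ψ.Realize (Sum.elim (fun b : B => (b : M)) ![c]))
    {N : Type w} [L.Structure N] (f : M ↪ₑ[L] N) {c : Fin 1 → N} (hθ : θ ∈ typeVia B f c) :
    ψ ∈ typeVia B f c := by
  have h1 : (Formula.iAlls (Fin 1) (θ.imp ψ)).Realize (fun b : B => (b : M)) := by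
    rw [Formula.realize_iAlls]
    intro c
    have hc : c = ![c 0] := by funext i; fin_cases i; rfl
    rw [hc, Formula.realize_imp]
    exact h _
  have h2 := (f.map_formula _ _).2 h1
  rw [Formula.realize_iAlls] at h2
  exact Formula.realize_imp.1 (h2 c) hθ

/-- The isolating formula defines the deciding set. Negated instances are covered because the
decision is symmetric in the two points, and the implications pass to elementary extensions. -/
theorem LocallyIsolatedAt.exists_implies {B : Set M} {c : M} (h : LocallyIsolatedAt L B c) {m : ℕ}
    (φ : L.Formula (Fin 1 ⊕ Fin m)) :
    ∃ θ ∈ typeOver B ![c], Implies B {θ} (restrictTo B (typeOver B ![c]) φ) := by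
  obtain ⟨X, ⟨θ, hθ⟩, hc, hdec⟩ := h m φ
  refine ⟨θ, (hθ c).1 hc, fun N _ f c' hc' ψ hψ => ?_⟩
  refine mem_typeVia_of_forall (fun c'' hc'' => ?_) f (hc' rfl)
  obtain ⟨hψc, b, rfl | rfl⟩ := hψ
  · rw [realize_inst]
    exact hdec _ (fun i => (b i).2) c hc c'' ((hθ _).2 hc'')
      ((realize_inst φ b (fun b : B => (b : M)) _).1 hψc)
  · have hψc' : ¬ (inst B φ b).Realize (Sum.elim (fun b : B => (b : M)) ![c]) := hψc
    rw [realize_inst] at hψc'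
    rw [Formula.realize_not, realize_inst]
    exact fun h => hψc' (hdec _ (fun i => (b i).2) c'' ((hθ _).2 hc'') c hc h)

theorem LocallyIsolatedAt.isLocallyIsolated {B : Set M} {c : M} (h : LocallyIsolatedAt L B c) :
    IsLocallyIsolated B (typeOver (L := L) B ![c]) :=
  fun _ φ => h.exists_implies φ

/-- One isolating formula for each parameter-free `φ` is enough: there are countably many `φ`, and
every formula over `B` is an instance of one of them. -/
theorem LocallyIsolatedAt.isIsolatedBelow (hL : L.card ≤ ℵ₀) {B : Set M} {c : M}
    (h : LocallyIsolatedAt L B c) : IsIsolatedBelow ℵ₁ B (typeOver (L := L) B ![c]) := by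
  have hcount : Countable (Σ m, L.Formula (Fin 1 ⊕ Fin m)) := by
    have := fun m => countable_formula hL (Fin 1 ⊕ Fin m) 0
    infer_instance
  choose θ hθ hθ' using fun φ : Σ m, L.Formula (Fin 1 ⊕ Fin m) => h.exists_implies φ.2
  refine ⟨Set.range θ, Set.range_subset_iff.2 hθ, ?_, fun N _ f c' hc' ψ hψ => ?_⟩
  · exact (mk_le_aleph0_iff.2 (Set.countable_range θ).to_subtype).trans_lt aleph0_lt_aleph_one
  · obtain ⟨n, a, ψ', -, hψ'⟩ := exists_finite_support.{u, v, w} ψ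
    have hinst : ∀ (N : Type w) [L.Structure N] (f : B → N) (c : Fin 1 → N),
        (inst B (ψ'.relabel Sum.swap) a).Realize (Sum.elim f c) ↔ ψ.Realize (Sum.elim f c) := by
      intro N _ f c
      rw [realize_inst, Formula.realize_relabel, ← hψ' N]
      refine iff_of_eq (congrArg _ ?_)
      funext i; rcases i with i | i <;> rfl
    have hmem : inst B (ψ'.relabel Sum.swap) a ∈
        restrictTo B (typeOver B ![c]) (ψ'.relabel Sum.swap) :=
      ⟨(hinst M (fun b : B => (b : M)) ![c]).2 hψ, a, Or.inl rfl⟩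
    exact (hinst N _ _).1 (hθ' ⟨n, ψ'.relabel Sum.swap⟩ N f c'
      (Set.singleton_subset_iff.2 (hc' ⟨_, rfl⟩)) hmem)

theorem realize_elementarySubstructure (S : L.ElementarySubstructure M) {γ : Type*}
    (φ : L.Formula γ) (x : γ → S) : φ.Realize (fun i => (x i : M)) ↔ φ.Realize x :=
  S.subtype.map_formula φ x

theorem LocallyIsolatedAt.restrict (S : L.ElementarySubstructure M) {B : Set S} {c : S}
    (h : LocallyIsolatedAt L (Subtype.val '' B) (c : M)) : LocallyIsolatedAt L B c := by
  intro m φ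
  obtain ⟨X, ⟨θ, hθ⟩, hc, hdec⟩ := h m φ
  have hval : ∀ {m : ℕ} (c : S) (b : Fin m → S),
      (fun i => ((Sum.elim ![c] b : Fin 1 ⊕ Fin m → S) i : M)) =
        Sum.elim ![(c : M)] fun i => (b i : M) := by
    intro m c b
    funext i
    rcases i with i | i
    · fin_cases i; rfl
    · rfl
  refine ⟨Subtype.val ⁻¹' X, ?_, hc, fun b hb c hc c' hc' hφ => ?_⟩
  · choose r hr hr' using fun b : (Subtype.val '' B : Set M) => b.2
    refine ⟨θ.relabel (Sum.map (fun b => ⟨r b, hr b⟩) id), fun c => ?_⟩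
    rw [Set.mem_preimage, hθ, Formula.realize_relabel, ← realize_elementarySubstructure]
    refine iff_of_eq (congrArg _ ?_)
    funext i
    rcases i with i | i
    · exact (hr' i).symm
    · fin_cases i; rfl
  · have h1 := hdec (fun i => (b i : M)) (fun i => ⟨_, hb i, rfl⟩) c hc c' hc'
    rw [← hval, ← hval, realize_elementarySubstructure, realize_elementarySubstructure] at h1
    exact h1 hφ

/-- A set that meets every nonempty set defined over it is an elementary substructure. -/
theorem exists_elementarySubstructure {C : Set M}
    (hC : ∀ X, DefinedOver L C X → X.Nonempty → (X ∩ C).Nonempty) :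
    ∃ S : L.ElementarySubstructure M, (S : Set M) = C := by
  let S : L.Substructure M :=
    { carrier := C
      -- The singleton of a function value is definable over the arguments, so `C` must meet it.
      fun_mem := by
        intro n F x hx
        obtain ⟨y, hy, hyC⟩ := hC {Structure.funMap F x} (by
          convert! DefinedOver.of_formula (A := C) ((Term.func F fun i => Term.var (Sum.inl i)).equal
            (Term.var (Sum.inr 0)) : L.Formula (Fin n ⊕ Fin 1)) (v := x) hx
          ext c
          simp [Formula.realize_equal, eq_comm]) (Set.singleton_nonempty _)
        exact hy ▸ hyC }
  refine ⟨⟨S, S.isElementary_of_exists fun n φ x a ha => ?_⟩, rfl⟩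
  have hX : DefinedOver L C {c | φ.Realize default (Fin.snoc (fun i => (x i : M)) c)} := by
    convert! DefinedOver.of_formula (A := C) (φ.toFormula.relabel
      (Sum.elim Empty.elim (Fin.lastCases (Sum.inr 0) Sum.inl)) : L.Formula (Fin n ⊕ Fin 1))
      (v := fun i => (x i : M)) (fun i => (x i).2) using 3 with c
    rw [Formula.realize_relabel, BoundedFormula.realize_toFormula]
    refine iff_of_eq (congrArg₂ _ (Subsingleton.elim _ _) ?_)
    funext i
    refine Fin.lastCases ?_ (fun i => ?_) i <;> simp
  obtain ⟨b, hb, hbC⟩ := hC _ hX ⟨a, ha⟩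
  exact ⟨⟨b, hbC⟩, hb⟩

end Isolated

/-! ### The existence theorem -/

/-- The diagonal embedding into an ultrapower. -/
def diagonal (L : FirstOrder.Language.{u, v}) {I : Type*} (U : Ultrafilter I) (M : Type*)
    [L.Structure M] [Nonempty M] : M ↪ₑ[L] ((U : Filter I).Product fun _ => M) where
  toFun a := ultraMk U fun _ => a
  map_formula' n φ x := by
    refine (realize_ultraMk (U := U) φ fun b _ => x b).trans ?_
    exact Filter.eventually_const

theorem map_mem_predSet {M N : Type*} [L.Structure M] [L.Structure N] (f : M ↪ₑ[L] N)
    (P : L.Relations 1) (a : M) : f a ∈ predSet P N ↔ a ∈ predSet P M := by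
  have h := f.map_rel P ![a]
  have h1 : f ∘ ![a] = ![f a] := by funext i; fin_cases i; rfl
  rwa [h1] at h

theorem IsCompleteSet.image {M N : Type w} [L.Structure M] [L.Structure N] (f : M ↪ₑ[L] N)
    {P : L.Relations 1} {A : Set M} (hA : IsCompleteSet P A) : IsCompleteSet P (f '' A) := by
  intro m n ψ b hb hx
  choose a ha hab using hb
  obtain rfl : (fun i => f (a i)) = b := funext hab
  have h1 := (f.map_formula (exIn P ψ) a).1 ((realize_exIn P ψ _).2 hx)
  obtain ⟨x, hx, hψ⟩ := hA m n ψ a ha ((realize_exIn P ψ _).1 h1)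
  refine ⟨fun i => f (x i), fun i => ⟨⟨_, (hx i).1, rfl⟩, (map_mem_predSet f P _).2 (hx i).2⟩, ?_⟩
  rw [← f.map_formula] at hψ
  convert hψ using 1
  funext i; rcases i with i | i <;> rfl

/-- A bijection between sets that preserves the predicates is an isomorphism. -/
noncomputable def equivOfBijective {M N : Type*} [(predLang L).Structure M]
    [(predLang L).Structure N] (e : M → N) (he : Function.Bijective e)
    (h : ∀ {n} (R : L.Relations n) (x : Fin n → M),
      Structure.RelMap (L := predLang L) R (e ∘ x) ↔ Structure.RelMap (L := predLang L) R x) :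
    M ≃[predLang L] N where
  toEquiv := Equiv.ofBijective e he
  map_fun' f _ := nomatch f
  map_rel' R x := h R x

theorem exists_countablySaturated {T : L.Theory} (M : Theory.ModelType.{u, v, w} T) :
    ∃ (N : Theory.ModelType.{u, v, w} T) (_ : M ↪ₑ[L] N), CountablySaturated L N := by
  let U : Ultrafilter ℕ := Filter.hyperfilter ℕ
  have hN : (U : Filter ℕ).Product (fun _ => (M : Type w)) ⊨ T :=
    ultraproduct_models fun _ => M.is_model
  exact ⟨Theory.ModelType.of T ((U : Filter ℕ).Product fun _ => (M : Type w)), diagonal L U M,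
    countablySaturated_ultrapower (M : Type w)⟩

/-- Over a complete set all of whose complete extensions with the same `P`-part are stable, there
is a locally constructible model with the same `P`-part. -/
theorem exists_constructible_model (hL : L.card ≤ ℵ₀) {T : L.Theory} {P : L.Relations 1}
    (M₀ : Theory.ModelType.{u, v, w} T) (hP : (predSet P M₀).Nonempty) (A : Set M₀)
    (hA : IsCompleteSet P A)
    (hst : FullyStableOver T P (A ∩ predSet P M₀ : Set M₀)) :
    ∃ (M : Theory.ModelType.{u, v, w} T) (j : A → M), ExtendsWithSameP P A j ∧
      #M ≤ #A + ℵ₀ ∧ LocallyConstructible L (Set.range j) Set.univ ∧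
        ConstructibleBelow L ℵ₁ (Set.range j) Set.univ := by
  obtain ⟨N, f, hsat⟩ := exists_countablySaturated M₀
  have hPN : (predSet P N).Nonempty := by
    obtain ⟨x, hx⟩ := hP
    exact ⟨f x, (map_mem_predSet f P x).2 hx⟩
  have hfA : IsCompleteSet P (f '' A) := hA.image f
  -- Being witnessed forces the `P`-part of `B` into the image of `A`, so `f` identifies it with the
  -- `P`-part of `A`.
  have hst' : ∀ B : Set N, f '' A ⊆ B → WitnessedBy P (f '' A) B → IsStableSet T P B := by
    intro B hAB hB
    refine hst N B (hB.isCompleteSet hAB) ⟨equivOfBijective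
      (fun a => ⟨f a.1, hAB ⟨_, a.2.1, rfl⟩, (map_mem_predSet f P _).2 a.2.2⟩) ⟨?_, ?_⟩ ?_⟩
    · intro a b hab
      exact Subtype.ext (f.injective (congrArg Subtype.val hab))
    · rintro ⟨b, hb⟩
      obtain ⟨a, ha, rfl⟩ := hB.inter_subset hb
      exact ⟨⟨a, ha, (map_mem_predSet f P _).1 hb.2⟩, rfl⟩
    · intro n R x
      exact f.map_rel R fun i => (x i : M₀)
  obtain ⟨d, hd, hwit, hTV⟩ := exists_construction hL N hsat hPN hfA hst'
  obtain ⟨S, hS⟩ := exists_elementarySubstructure hTV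
  have hmem : ∀ x : N, x ∈ S ↔ x ∈ f '' A ∪ Set.range d := fun x => by
    rw [← hS]; rfl
  let j : A → S := fun a => ⟨f a, (hmem _).2 (Or.inl ⟨_, a.2, rfl⟩)⟩
  let o : Ordinal.{w} := (#(f '' A : Set N) + ℵ₀).ord
  let dS : Set.Iio o → S := fun i => ⟨d (Ordinal.ToType.mk i), (hmem _).2 (Or.inr ⟨_, rfl⟩)⟩
  have hval : ∀ i, Subtype.val '' (Set.range j ∪ dS '' Set.Iio i) =
      f '' A ∪ d '' Set.Iio (Ordinal.ToType.mk i) := by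
    intro i
    rw [Set.image_union]
    congr 1
    · ext x
      constructor
      · rintro ⟨_, ⟨a, rfl⟩, rfl⟩
        exact ⟨a, a.2, rfl⟩
      · rintro ⟨a, ha, rfl⟩
        exact ⟨_, ⟨⟨a, ha⟩, rfl⟩, rfl⟩
    · ext x
      constructor
      · rintro ⟨_, ⟨k, hk, rfl⟩, rfl⟩
        exact ⟨_, (Ordinal.ToType.mk.lt_iff_lt).2 hk, rfl⟩
      · rintro ⟨k, hk, rfl⟩
        obtain ⟨k, rfl⟩ := Ordinal.ToType.mk.surjective k
        exact ⟨_, ⟨k, (Ordinal.ToType.mk.lt_iff_lt).1 hk, rfl⟩, rfl⟩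
  have hiso : ∀ i, LocallyIsolatedAt L (Set.range j ∪ dS '' Set.Iio i) (dS i) := by
    intro i
    refine LocallyIsolatedAt.restrict S ?_
    rw [hval]
    exact hd _
  have huniv : (Set.univ : Set S) = Set.range j ∪ Set.range dS := by
    refine (Set.eq_univ_of_forall fun x => ?_).symm
    rcases (hmem _).1 x.2 with ⟨a, ha, hx⟩ | ⟨k, hk⟩
    · exact Or.inl ⟨⟨a, ha⟩, Subtype.ext hx⟩
    · refine Or.inr ⟨Ordinal.ToType.mk.symm k, Subtype.ext ?_⟩
      exact (congrArg d (Ordinal.ToType.mk.apply_symm_apply k)).trans hk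
  refine ⟨Theory.ModelType.of T S, j, ⟨?_, ?_⟩, ?_, ⟨o, dS, huniv, fun i =>
    (hiso i).isLocallyIsolated⟩, ⟨o, dS, huniv, fun i => (hiso i).isIsolatedBelow hL⟩⟩
  · intro n φ a
    exact (realize_elementarySubstructure S φ fun i => j (a i)).symm.trans
      (f.map_formula φ fun i => (a i : M₀))
  · ext x
    refine (map_mem_predSet S.subtype P x).symm.trans ⟨fun hx => ?_, ?_⟩
    · obtain ⟨a, ha, hax⟩ := hwit.inter_subset ⟨(hmem _).1 x.2, hx⟩
      refine ⟨⟨a, ha⟩, ?_, Subtype.ext hax⟩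
      rw [Set.mem_ofPred_eq, ← map_mem_predSet f, hax]
      exact hx
    · rintro ⟨a, ha, rfl⟩
      exact (map_mem_predSet f P a).2 ha
  · have h1 : #S = #(f '' A ∪ Set.range d : Set N) := by
      rw [← hS]; rfl
    have h2 : #(f '' A : Set N) = #A := mk_image_eq f.injective
    have h3 : #(Set.range d) ≤ #A + ℵ₀ := by
      refine mk_range_le.trans ?_
      rw [mk_constrIndex, h2]
    have h4 : #S ≤ #A + (#A + ℵ₀) := by
      rw [h1]
      exact (mk_union_le _ _).trans (add_le_add h2.le h3)
    refine h4.trans (le_of_eq ?_)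
    exact add_eq_right (self_le_add_left _ _) (self_le_add_right _ _)

/-! ### The Gaifman property -/

section QuantifierFree

variable {M : Type w} [L.Structure M] {B : Set M}

theorem realize_onTerm_predHom {γ : Type*} (t : (predLang L).Term γ) (x : γ → B) :
    ((predHom L).onTerm t).realize (fun i => (x i : M)) = (t.realize x : B) := by
  cases t with
  | var i => rfl
  | func f _ => exact nomatch f

/-- Quantifier-free formulas in the predicates are absolute between a subset and its ambient model.
With quantifier elimination this makes truth about elements of `P` computable inside the `P`-part.
-/
theorem realize_onFormula_predHom {γ : Type*} {θ : (predLang L).Formula γ} (hθ : θ.IsQF)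
    (x : γ → B) : ((predHom L).onFormula θ).Realize (fun i => (x i : M)) ↔ θ.Realize x := by
  suffices h : ∀ {n} {θ : (predLang L).BoundedFormula γ n}, θ.IsQF → ∀ y : Fin n → B,
      ((predHom L).onBoundedFormula θ).Realize (fun i => (x i : M)) (fun i => (y i : M)) ↔
        θ.Realize x y by
    have h1 := h hθ default
    have h2 : (fun i => ((default : Fin 0 → B) i : M)) = default := Subsingleton.elim _ _
    rwa [h2] at h1
  intro n θ hθ y
  have hxy : (Sum.elim (fun i => (x i : M)) fun i => (y i : M)) =
      fun i => ((Sum.elim x y i : B) : M) := by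
    funext i; rcases i with i | i <;> rfl
  induction hθ with
  | falsum => rfl
  | of_isAtomic h =>
    cases h with
    | equal t₁ t₂ =>
      change Term.realize _ ((predHom L).onTerm t₁) = Term.realize _ ((predHom L).onTerm t₂) ↔
        t₁.realize _ = t₂.realize _
      rw [hxy, realize_onTerm_predHom, realize_onTerm_predHom]
      exact Subtype.ext_iff.symm
    | rel R ts =>
      change Structure.RelMap (L := L) R (fun i => Term.realize _ ((predHom L).onTerm (ts i))) ↔
        Structure.RelMap (L := L) R (fun i => ((Term.realize _ (ts i) : B) : M))
      simp only [hxy, realize_onTerm_predHom]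
  | imp _ _ h₁ h₂ => exact imp_congr h₁ h₂

end QuantifierFree

/-- Finitely many formulas true in a model of `T^P` are true in the `P`-part of a model of `T`. -/
theorem exists_finite_approximation {T : L.Theory} {P : L.Relations 1}
    (hP : ∀ M : Theory.ModelType.{u, v, w} T, (predSet P M).Nonempty) {N : Type w}
    [(predLang L).Structure N] (hN : N ⊨ theoryOfP.{u, v, w} T P)
    (e : ℕ → Σ n, (predLang L).Formula (Fin n)) (s : Finset (Σ c : ℕ, Fin (e c).1 → N)) :
    ∃ (M : Theory.ModelType.{u, v, w} T) (x : N → predSet P M), ∀ k ∈ s,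
      (e k.1).2.Realize k.2 → (e k.1).2.Realize (x ∘ k.2) := by
  classical
  let Φ : (predLang L).Formula (N ⊕ Empty) := Formula.iInf fun k : s =>
    if (e k.1.1).2.Realize k.1.2 then (e k.1.1).2.relabel (Sum.inl ∘ k.1.2) else ⊤
  obtain ⟨n, a, φ, ha, hφ⟩ := exists_finite_support.{0, v, w} Φ
  let σ : (predLang L).Sentence := Formula.iExs (Fin n) (φ.relabel Sum.swap)
  have hσ : ∀ (M : Type w) [(predLang L).Structure M], M ⊨ σ ↔
      ∃ y : Fin n → M, φ.Realize (Sum.elim y default) := by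
    intro M _
    rw [Sentence.Realize, Formula.realize_iExs]
    refine exists_congr fun y => ?_
    rw [Formula.realize_relabel]
    refine iff_of_eq (congrArg _ ?_)
    funext i; rcases i with i | i <;> rfl
  have hΦ : ∀ (M : Type w) [(predLang L).Structure M] (x : N → M),
      Φ.Realize (Sum.elim x default) ↔
        ∀ k ∈ s, (e k.1).2.Realize k.2 → (e k.1).2.Realize (x ∘ k.2) := by
    intro M _ x
    rw [Formula.realize_iInf]
    refine ⟨fun h k hk hr => ?_, fun h k => ?_⟩
    · have h1 := h ⟨k, hk⟩
      rw [if_pos hr, Formula.realize_relabel] at h1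
      exact h1
    · split_ifs with hr
      · rw [Formula.realize_relabel]
        exact h k.1 k.2 hr
      · simp [Formula.Realize]
  have hNσ : N ⊨ σ := by
    rw [hσ]
    refine ⟨a, (hφ N id default).2 ((hΦ N id).2 fun k _ hk => hk)⟩
  obtain ⟨M, hM⟩ : ∃ M : Theory.ModelType.{u, v, w} T, (predSet P M) ⊨ σ := by
    by_contra! hcon
    have : σ.not ∈ theoryOfP.{u, v, w} T P := fun M => (Formula.realize_not).2 (hcon M)
    exact (Formula.realize_not.1 (hN.realize_of_mem _ this)) hNσ
  obtain ⟨y, hy⟩ := (hσ _).1 hM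
  obtain ⟨p, hp⟩ := hP M
  refine ⟨M, Function.extend a y fun _ => ⟨p, hp⟩, (hΦ _ _).1 ((hφ _ _ _).1 ?_)⟩
  have : (Function.extend a y fun _ => ⟨p, hp⟩) ∘ a = y := funext fun i => ha.extend_apply _ _ i
  rwa [this]

/-- Every model of `T^P` is isomorphic to a complete subset of the `P`-part of a model of `T`. -/
theorem exists_complete_copy (hL : L.card ≤ ℵ₀) {T : L.Theory} {P : L.Relations 1}
    (hP : ∀ M : Theory.ModelType.{u, v, w} T, (predSet P M).Nonempty)
    (hQE : ∀ (n : ℕ) (φ : L.Formula (Fin n)), ∃ θ : (predLang L).Formula (Fin n), θ.IsQF ∧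
      T.Iff φ ((predHom L).onFormula θ)) {N : Type w}
    [(predLang L).Structure N] (hN : N ⊨ theoryOfP.{u, v, w} T P) :
    ∃ (M : Theory.ModelType.{u, v, w} T) (g : N → M), Function.Injective g ∧
      (∀ {n} (R : L.Relations n) (x : Fin n → N), Structure.RelMap R (g ∘ x) ↔
        Structure.RelMap (L := predLang L) R x) ∧
      Set.range g ⊆ predSet P M ∧ IsCompleteSet P (Set.range g) := by
  have : ∀ n, Countable ((predLang L).Formula (Fin n)) := fun n =>
    countable_formula (card_predLang_le hL) _ _
  have : Nonempty (Σ n, (predLang L).Formula (Fin n)) := ⟨⟨0, ⊤⟩⟩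
  obtain ⟨e, he⟩ := exists_surjective_nat (Σ n, (predLang L).Formula (Fin n))
  choose M x hx using exists_finite_approximation hP hN e
  let I := Finset (Σ c : ℕ, Fin (e c).1 → N)
  let U : Ultrafilter I := Ultrafilter.of Filter.atTop
  have key : ∀ {n} (φ : (predLang L).Formula (Fin n)) (y : Fin n → N), φ.Realize y →
      ∀ᶠ s in (U : Filter I), φ.Realize (x s ∘ y) := by
    intro n φ y hy
    obtain ⟨c, hc⟩ := he ⟨n, φ⟩
    have h1 : ∀ q : Σ n, (predLang L).Formula (Fin n), e c = q → ∀ y : Fin q.1 → N,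
        q.2.Realize y → ∀ᶠ s in (U : Filter I), q.2.Realize (x s ∘ y) := by
      rintro q rfl y hy
      refine Ultrafilter.of_le _ ((Filter.eventually_ge_atTop {⟨c, y⟩}).mono fun s hs => ?_)
      exact hx s _ (Finset.singleton_subset_iff.1 hs) hy
    exact h1 _ hc y hy
  -- Applying the forward direction to the negation shows that `N` is elementarily embedded in the
  -- ultraproduct of the `P`-parts.
  have key' : ∀ {n} (φ : (predLang L).Formula (Fin n)) (y : Fin n → N),
      (∀ᶠ s in (U : Filter I), φ.Realize (x s ∘ y)) ↔ φ.Realize y := by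
    intro n φ y
    refine ⟨fun h => ?_, key φ y⟩
    by_contra hcon
    obtain ⟨s, hs, hs'⟩ := (h.and (key φ.not y (Formula.realize_not.2 hcon))).exists
    exact Formula.realize_not.1 hs' hs
  have hmod : (U : Filter I).Product (fun s => (M s : Type w)) ⊨ T :=
    ultraproduct_models fun s => (M s).is_model
  let g : N → (U : Filter I).Product fun s => (M s : Type w) := fun a =>
    ultraMk U fun s => (x s a : M s)
  have hgP : ∀ a, g a ∈ predSet P ((U : Filter I).Product fun s => (M s : Type w)) := fun a =>
    (ultraMk_mem_predSet P _).2 (Filter.Eventually.of_forall fun s => (x s a).2)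
  refine ⟨Theory.ModelType.of T ((U : Filter I).Product fun s => (M s : Type w)), g, ?_, ?_, ?_,
    ?_⟩
  · intro a b hab
    have h1 := (key' ((Term.var 0).equal (Term.var 1)) ![a, b]).1
      ((ultraMk_eq_iff.1 hab).mono fun s hs => by
        rw [Formula.realize_equal]
        exact Subtype.ext hs)
    simpa [Formula.realize_equal] using h1
  · intro n R y
    let R' : (predLang L).Relations n := R
    have h1 := (key' (R'.formula fun i => Term.var i) y).trans Formula.realize_rel
    refine (relMap_ultraMk R fun i s => (x s (y i) : M s)).trans
      (Iff.trans (Filter.eventually_congr (Filter.Eventually.of_forall fun s => ?_)) h1)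
    exact (Formula.realize_rel (M := predSet P (M s)) (R := R') (v := x s ∘ y)
      (ts := fun i => Term.var i)).symm
  · rintro _ ⟨a, rfl⟩
    exact hgP a
  · rintro m n ψ b hb ⟨y, hyP, hy⟩
    choose b' hb' using hb
    obtain rfl : (fun i => g (b' i)) = b := funext hb'
    choose z hz using fun i => ultraMk_surjective (y i)
    obtain rfl : (fun i => ultraMk U (z i)) = y := funext hz
    obtain ⟨θ, hθ, hiff⟩ := hQE (m + n) (ψ.relabel finSumFinEquiv)
    have hQ : ∀ s (p : Fin m → predSet P (M s)) (q : Fin n → predSet P (M s)),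
        ψ.Realize (Sum.elim (fun i => (p i : M s)) fun i => (q i : M s)) ↔
          (θ.relabel (finSumFinEquiv.symm)).Realize (Sum.elim p q) := by
      intro s p q
      have h1 := hiff.realize_iff (M := M s) (v := fun i =>
        ((Sum.elim p q (finSumFinEquiv.symm i) : predSet P (M s)) : M s))
      have h2 := (realize_onFormula_predHom hθ
        fun i => Sum.elim p q (finSumFinEquiv.symm i))
      refine Iff.trans ?_ (h1.trans (h2.trans ?_))
      · refine Iff.trans ?_ Formula.realize_relabel.symm
        refine iff_of_eq (congrArg _ ?_)
        funext i
        rcases i with i | i <;> simp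
      · rw [Formula.realize_relabel]
        rfl
    have hlos : ∀ z : Fin m → ∀ s, M s,
        ψ.Realize (Sum.elim (fun i => ultraMk U (z i)) fun i => g (b' i)) ↔
          ∀ᶠ s in (U : Filter I), ψ.Realize (Sum.elim (fun i => z i s)
            fun i => (x s (b' i) : M s)) := by
      intro z
      have h2 : (Sum.elim (fun i => ultraMk U (z i)) fun i => g (b' i)) =
          fun q => ultraMk U ((Sum.elim z fun i s => (x s (b' i) : M s) :
            Fin m ⊕ Fin n → ∀ s, M s) q) := by
        funext i
        rcases i with i | i <;> rfl
      rw [h2, realize_ultraMk]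
      refine Filter.eventually_congr (Filter.Eventually.of_forall fun S =>
        iff_of_eq (congrArg _ ?_))
      funext i
      rcases i with i | i <;> rfl
    -- Existence of a witness in `P` becomes a first-order formula of the `P`-parts, which can be
    -- pulled back to `N`; a witness found in `N` is then sent forward by `g`.
    let χ : (predLang L).Formula (Fin n) :=
      Formula.iExs (Fin m) ((θ.relabel finSumFinEquiv.symm).relabel Sum.swap)
    have hχ : ∀ (K : Type w) [(predLang L).Structure K] (q : Fin n → K), χ.Realize q ↔
        ∃ p : Fin m → K, (θ.relabel finSumFinEquiv.symm).Realize (Sum.elim p q) := by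
      intro K _ q
      rw [Formula.realize_iExs]
      refine exists_congr fun p => ?_
      rw [Formula.realize_relabel]
      refine iff_of_eq (congrArg _ ?_)
      funext i; rcases i with i | i <;> rfl
    have hzP : ∀ᶠ s in (U : Filter I), ∀ i, z i s ∈ predSet P (M s) :=
      Filter.eventually_all.2 fun i => (ultraMk_mem_predSet P (z i)).1 (hyP i)
    have hχN : χ.Realize b' := by
      refine (key' χ b').1 ((hzP.and ((hlos z).1 hy)).mono fun s hs => ?_)
      exact (hχ _ _).2 ⟨fun i => ⟨z i s, hs.1 i⟩, (hQ s _ _).1 hs.2⟩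
    obtain ⟨p, hp⟩ := (hχ _ _).1 hχN
    refine ⟨fun i => g (p i), fun i => ⟨⟨_, rfl⟩, hgP _⟩, ?_⟩
    refine (hlos fun i s => (x s (p i) : M s)).2 ?_
    have h3 := key θ (fun i => Sum.elim p b' (finSumFinEquiv.symm i))
      (Formula.realize_relabel.1 hp)
    refine h3.mono fun s hs => (hQ s (fun i => x s (p i)) fun i => x s (b' i)).2 ?_
    rw [Formula.realize_relabel]
    convert hs using 1
    funext i
    simp only [Function.comp_apply]
    rcases finSumFinEquiv.symm i with i | i <;> rfl

/-- The complete copy of `N` lies inside `P`, so it is its own `P`-part; an extension to a model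
with the same `P`-part has `N` as its `P`-part. -/
theorem gaifmanProperty_of_fullExistence (hL : L.card ≤ ℵ₀) {T : L.Theory} {P : L.Relations 1}
    (hT : StandingHypotheses.{u, v, w} T P) (h : FullExistence.{u, v, w} T P) :
    GaifmanProperty.{u, v, w} T P := by
  intro N _ hN
  obtain ⟨M₀, g, hg, hR, hgP, hcomp⟩ := exists_complete_copy hL
    (fun M => (hT.infinite M).nonempty) hT.quantifierElimination hN
  obtain ⟨M, j, hj, hjP⟩ := h M₀ _ hcomp
  let e : N → predSet P M := fun a => ⟨j ⟨g a, a, rfl⟩, by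
    rw [hjP]
    exact ⟨⟨g a, a, rfl⟩, hgP ⟨a, rfl⟩, rfl⟩⟩
  refine ⟨M, ⟨equivOfBijective e ⟨fun a b hab => hg ?_, ?_⟩ ?_⟩⟩
  · have h1 := hj 2 ((Term.var 0).equal (Term.var 1)) ![⟨g a, a, rfl⟩, ⟨g b, b, rfl⟩]
    simp only [Formula.realize_equal, Term.realize_var] at h1
    exact h1.1 (congrArg Subtype.val hab)
  · rintro ⟨y, hy⟩
    have hy' := hy
    rw [hjP] at hy'
    obtain ⟨⟨_, a, rfl⟩, -, ha⟩ := hy'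
    exact ⟨a, Subtype.ext ha⟩
  · intro n R y
    have h1 := hj n (R.formula fun i => Term.var i) fun i => ⟨g (y i), y i, rfl⟩
    rw [Formula.realize_rel, Formula.realize_rel] at h1
    exact h1.trans (hR R y)

theorem HasPPart.fullyStableOver {T : L.Theory} {P : L.Relations 1} {N : Type w}
    [(predLang L).Structure N] {M : Type w} [L.Structure M] {A : Set M} (hA : HasPPart P N A)
    (h : FullyStableOver T P N) : FullyStableOver T P (A ∩ predSet P M : Set M) := by
  intro M' B hB hAB
  obtain ⟨f⟩ := hA
  obtain ⟨f'⟩ := hAB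
  exact h M' B hB ⟨f'.comp f⟩

end OverPredicate

/-! ### The theorem -/

theorem mainTheorem1 {L : FirstOrder.Language.{u, v}} (hL : L.card ≤ ℵ₀) (T : L.Theory)
    (P : L.Relations 1) (hT : OverPredicate.StandingHypotheses.{u, v, w} T P) :
    (∀ (N : Type w) [(OverPredicate.predLang L).Structure N],
      N ⊨ OverPredicate.theoryOfP.{u, v, w} T P → OverPredicate.FullyStableOver T P N →
        OverPredicate.FullExistenceOver T P N ∧
        ∀ (M₀ : FirstOrder.Language.Theory.ModelType.{u, v, w} T) (A : Set M₀),
          OverPredicate.IsCompleteSet P A → OverPredicate.HasPPart P N A →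
            ∃ (M : FirstOrder.Language.Theory.ModelType.{u, v, w} T) (j : A → M),
              OverPredicate.ExtendsWithSameP P A j ∧
              #M ≤ #A + ℵ₀ ∧
              OverPredicate.LocallyConstructible L (Set.range j) Set.univ ∧
              OverPredicate.ConstructibleBelow L ℵ₁ (Set.range j) Set.univ) ∧
    (OverPredicate.FullyStable.{u, v, w} T P →
      OverPredicate.FullExistence.{u, v, w} T P ∧
      OverPredicate.GaifmanProperty.{u, v, w} T P) := by
  constructor
  · intro N _ _ hst
    have key : ∀ (M₀ : FirstOrder.Language.Theory.ModelType.{u, v, w} T) (A : Set M₀),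
        OverPredicate.IsCompleteSet P A → OverPredicate.HasPPart P N A → _ :=
      fun M₀ A hA hNA => OverPredicate.exists_constructible_model hL M₀
        (hT.infinite M₀).nonempty A hA (hNA.fullyStableOver hst)
    refine ⟨fun M₀ A hA hNA => ?_, key⟩
    obtain ⟨M, j, hj, -⟩ := key M₀ A hA hNA
    exact ⟨M, j, hj⟩
  · intro hst
    have hfull : OverPredicate.FullExistence.{u, v, w} T P := fun M₀ A hA => by
      obtain ⟨M, j, hj, -⟩ := OverPredicate.exists_constructible_model hL M₀
        (hT.infinite M₀).nonempty A hA fun M' B hB _ => hst M' B hB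
      exact ⟨M, j, hj⟩
    exact ⟨hfull, OverPredicate.gaifmanProperty_of_fullExistence hL hT hfull⟩
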